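/- **Setting.** Let $n\ge 1$ and let $\gamma_1,\dots,\gamma_{2n}$ be the Majorana operators on $n$ qubits in the Jordan–Wigner encoding, $\gamma_{2j-1}=\big(\prod_{k<j}Z_k\big)X_j$ and $\gamma_{2j}=\big(\prod_{k<j}Z_k\big)Y_j$. Put $B_{ab}=-i\gamma_a\gamma_b$ for $a<b$. The covariance matrix of a state $\rho$ is $(\Gamma_\rho)_{ab}=-\tfrac i2\operatorname{tr}(\rho[\gamma_a,\gamma_b])$, and $\operatorname{FAF}_1(\rho)=n-\tfrac12\operatorname{tr}(-\Gamma_\rho^2)$. A pure state $\psi$ is Gaussian if $\Gamma_\psi^2=-\mathbb I_{2n}$; $\mathcal G_n$ is the set of pure Gaussian states, and $\epsilon_G(\psi)=\min_{\phi\in\mathcal G_n}\tfrac12\|\,|\psi\rangle\langle\psi|-|\phi\rangle\langle\phi|\,\|_1$. A single-copy protocol with $N$ shots measures each of $N$ copies of the unknown state separately and accepts or rejects according to the $N$ outcomes. It is an $(\epsilon,\delta)$-tester if $\Pr[\text{accept}]\ge1-\delta$ for every $\psi\in\mathcal G_n$ and $\Pr[\text{reject}]\ge1-\delta$ for every pure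 state $\psi$ with $\epsilon_G(\psi)\ge\epsilon$. **The protocol.** Let $m=2n-1$. For $\ell=1,\dots,m$ let the layer $\mathcal M_\ell$ consist of the pair $(\ell,2n)$ and of the pairs $\{\ell+j,\ell-j\}$, $1\le j\le n-1$, where $\ell\pm j$ are reduced modulo $m$ to $\{1,\dots,m\}$ and each pair is put in increasing order. In one run, for each $\ell$, the operators $B_e$, $e\in\mathcal M_\ell$, are measured jointly (projectively) on $M\ge2$ fresh copies, with outcomes $X_{\ell,1},\dots,X_{\ell,M}\in\{\pm1\}^{\mathcal M_\ell}$, and $$\widehat{\operatorname{FAF}}_1=n-\sum_{\ell=1}^{2n-1}\binom M2^{-1}\sum_{1\le r<s\le M}\ \sum_{e\in\mathcal M_\ell}X_{\ell,r}^eX_{\ell,s}^e .$$ The matching protocol with parameters $(M,k,\tau)$ performs $2k+1$ independent runs, hence $(2k+1)(2n-1)M$ shots, and accepts if and only if the median of the $2k+1$ values $\widehat{\operatorname{FAF}}_1$ is at most $\tau$. **Theorem (Single-copy Gaussianity test).** 1. For every $n$, each $\mathcal M_\ell$ consists of $n$ pairs $(a,b)$ with $a<b$, every pair $(a,b)$ with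 $1\le a<b\le 2n$ occurs exactly once in exactly one of the $2n-1$ layers, and the operators $B_e$, $e\in\mathcal M_\ell$, commute. 2. There is a universal constant $C>0$ such that for all $n\ge1$, $M\ge2$ and every $n$-qubit state $\rho$, the estimate from one run on copies of $\rho$ satisfies $\mathbb E\big[\widehat{\operatorname{FAF}}_1\big]=\operatorname{FAF}_1(\rho)$ and $\operatorname{Var}\big(\widehat{\operatorname{FAF}}_1\big)\le C\left(\dfrac{n^2}{M}+\dfrac{n^3}{M^2}\right)$. 3. For every $\delta_0\in(0,1)$ there is a constant $C>0$, depending only on $\delta_0$, such that for all $n\ge1$, $0<\epsilon\le1$ and $0<\delta\le\delta_0$ there are integers $M\ge2$ and $k\ge0$ for which the matching protocol with parameters $(M,k,\epsilon^2)$ uses at most $$C\,\frac{n^3}{\epsilon^4}\,\log\frac1\delta$$ single-copy shots and is an $(\epsilon,\delta)$-tester: it accepts every pure Gaussian state with probability at least $1-\delta$ and rejects every pure state with $\epsilon_G(\psi)\ge\epsilon$ with probability at least $1-\delta$. -/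

import Mathlib

open Matrix
open scoped ComplexOrder

namespace FermionTest

noncomputable section

/-! ### Qubits, Majorana operators, covariance matrix, fermionic antiflatness -/

/-- Computational basis labels of `n` qubits. -/
abbrev Bits (n : ℕ) : Type := Fin n → Fin 2

/-- Operators on the `n`-qubit space, as complex matrices in the computational basis. -/
abbrev Op (n : ℕ) : Type := Matrix (Bits n) (Bits n) ℂ

def pauliX : Matrix (Fin 2) (Fin 2) ℂ := !![0, 1; 1, 0]
def pauliY : Matrix (Fin 2) (Fin 2) ℂ := !![0, -Complex.I; Complex.I, 0]
def pauliZ : Matrix (Fin 2) (Fin 2) ℂ := !![1, 0; 0, -1]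

/-- The tensor product `P 0 ⊗ P 1 ⊗ ⋯ ⊗ P (n-1)` of one-qubit operators. -/
def tensorOp {n : ℕ} (P : Fin n → Matrix (Fin 2) (Fin 2) ℂ) : Op n :=
  Matrix.of fun x y => ∏ k, P k (x k) (y k)

/-- The tensor factor at site `k` of the Jordan--Wigner Majorana operator with index `a`
(indices start at `0`, so that the indices `2 * j` and `2 * j + 1` belong to mode `j`). -/
def jwFactor (a k : ℕ) : Matrix (Fin 2) (Fin 2) ℂ :=
  if k < a / 2 then pauliZ
  else if k = a / 2 then (if a % 2 = 0 then pauliX else pauliY)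
  else 1

/-- The Majorana operators `γ_a`, in the Jordan--Wigner encoding. -/
def majorana {n : ℕ} (a : Fin (2 * n)) : Op n := tensorOp fun k => jwFactor a k

/-- The Majorana bilinear `B_ab = -i γ_a γ_b`. -/
def bilinear {n : ℕ} (a b : Fin (2 * n)) : Op n := -Complex.I • (majorana a * majorana b)

/-- Density matrices. -/
def IsState {n : ℕ} (ρ : Op n) : Prop := ρ.PosSemidef ∧ ρ.trace = 1

/-- The covariance matrix `Γ_ab = -(i/2) tr (ρ [γ_a, γ_b])`; the trace is real for states. -/
def covariance {n : ℕ} (ρ : Op n) : Matrix (Fin (2 * n)) (Fin (2 * n)) ℝ :=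
  Matrix.of fun a b =>
    (-(Complex.I / 2) *
      (ρ * (majorana a * majorana b - majorana b * majorana a)).trace).re

/-- The fermionic antiflatness `FAF_k(ρ) = n - (1/2) tr ((-Γ²)^k)`. -/
def faf {n : ℕ} (k : ℕ) (ρ : Op n) : ℝ :=
  n - 1 / 2 * ((-(covariance ρ * covariance ρ)) ^ k).trace

/-! ### Pure states, pure Gaussian states and the distance to them -/

/-- Unit vectors of the `n`-qubit space. -/
def IsUnitVector {n : ℕ} (ψ : Bits n → ℂ) : Prop := star ψ ⬝ᵥ ψ = 1

/-- The rank-one operator `|ψ⟩⟨ψ|`. -/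
def ketbra {n : ℕ} (ψ : Bits n → ℂ) : Op n := vecMulVec ψ (star ψ)

/-- `ψ` is a pure fermionic Gaussian state: a unit vector with `Γ² = -1`. -/
def IsPureGaussian {n : ℕ} (ψ : Bits n → ℂ) : Prop :=
  IsUnitVector ψ ∧ covariance (ketbra ψ) * covariance (ketbra ψ) = -1

/-- The trace norm: the sum of the singular values, which are the square roots of the
eigenvalues of `Aᴴ A`. -/
def traceNorm {n : ℕ} (A : Op n) : ℝ :=
  ∑ i, Real.sqrt ((isHermitian_conjTranspose_mul_self A).eigenvalues i)

/-- The trace distance. -/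
def traceDist {n : ℕ} (ρ σ : Op n) : ℝ := 1 / 2 * traceNorm (ρ - σ)

/-- The trace distance of a pure state to the set of pure Gaussian states. -/
def gaussianDist {n : ℕ} (ψ : Bits n → ℂ) : ℝ :=
  ⨅ φ : {φ : Bits n → ℂ // IsPureGaussian φ}, traceDist (ketbra ψ) (ketbra φ.1)

/-! ### Single-copy measurement protocols -/

/-- A measurement on one copy of an `n`-qubit state with outcomes in `Ω`. -/
structure POVM (n : ℕ) (Ω : Type) [Fintype Ω] where
  effect : Ω → Op n
  posSemidef : ∀ x, (effect x).PosSemidef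
  sum_effect : ∑ x, effect x = 1

/-- Born's rule. -/
def POVM.prob {n : ℕ} {Ω : Type} [Fintype Ω] (E : POVM n Ω) (ρ : Op n) (x : Ω) : ℝ :=
  (ρ * E.effect x).trace.re

/-- The expectation of `f` applied to the list of outcomes, when for every `i : ι` the
measurement `E i` is applied to a fresh copy of `ρ`, independently of the others. -/
def expectation {n : ℕ} {ι Ω : Type} [Fintype ι] [DecidableEq ι] [Fintype Ω]
    (E : ι → POVM n Ω) (ρ : Op n) (f : (ι → Ω) → ℝ) : ℝ :=
  ∑ ω : ι → Ω, (∏ i, (E i).prob ρ (ω i)) * f ω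

/-- The variance of `f` under the same law. -/
def variance {n : ℕ} {ι Ω : Type} [Fintype ι] [DecidableEq ι] [Fintype Ω]
    (E : ι → POVM n Ω) (ρ : Op n) (f : (ι → Ω) → ℝ) : ℝ :=
  expectation E ρ fun ω => (f ω - expectation E ρ f) ^ 2

/-- A (non-adaptive) single-copy protocol: each shot measures one copy of the unknown state, and
a classical rule decides from all outcomes whether to accept or to reject. -/
structure SingleCopyProtocol (n : ℕ) where
  Shot : Type
  Outcome : Type
  [fintypeShot : Fintype Shot]
  [decidableEqShot : DecidableEq Shot]
  [fintypeOutcome : Fintype Outcome]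
  measurement : Shot → POVM n Outcome
  accept : Set (Shot → Outcome)

attribute [instance] SingleCopyProtocol.fintypeShot SingleCopyProtocol.decidableEqShot
  SingleCopyProtocol.fintypeOutcome

/-- The number of shots, that is, of copies of the state. -/
def SingleCopyProtocol.shots {n : ℕ} (P : SingleCopyProtocol n) : ℕ := Fintype.card P.Shot

def SingleCopyProtocol.acceptProb {n : ℕ} (P : SingleCopyProtocol n) (ρ : Op n) : ℝ :=
  expectation P.measurement ρ (P.accept.indicator 1)

def SingleCopyProtocol.rejectProb {n : ℕ} (P : SingleCopyProtocol n) (ρ : Op n) : ℝ :=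
  expectation P.measurement ρ (P.acceptᶜ.indicator 1)

/-- `(ε, δ)`-testers for pure-state fermionic Gaussianity. -/
def SingleCopyProtocol.IsGaussianityTester {n : ℕ} (P : SingleCopyProtocol n) (ε δ : ℝ) : Prop :=
  (∀ ψ : Bits n → ℂ, IsPureGaussian ψ → 1 - δ ≤ P.acceptProb (ketbra ψ)) ∧
  (∀ ψ : Bits n → ℂ, IsUnitVector ψ → ε ≤ gaussianDist ψ → 1 - δ ≤ P.rejectProb (ketbra ψ))

/-! ### The layers of commuting bilinears -/

/-- The pair number `j` of layer `ℓ`. With indices from `0` and `m = 2n - 1`: layer `ℓ` consists of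
`(ℓ, m)`, for `j = 0`, and of the ordered pairs `{ℓ + j mod m, ℓ - j mod m}`, `1 ≤ j ≤ n - 1`. -/
def layerPair {n : ℕ} (ℓ : Fin (2 * n - 1)) (j : Fin n) : Fin (2 * n) × Fin (2 * n) :=
  have hℓ : (ℓ : ℕ) < 2 * n - 1 := ℓ.isLt
  have hmod : ∀ x : ℕ, x % (2 * n - 1) < 2 * n := fun x =>
    lt_of_lt_of_le (Nat.mod_lt x (by omega)) (by omega)
  if (j : ℕ) = 0 then
    (⟨ℓ, by omega⟩, ⟨2 * n - 1, by omega⟩)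
  else
    let u : Fin (2 * n) := ⟨(ℓ + j) % (2 * n - 1), hmod _⟩
    let v : Fin (2 * n) := ⟨(ℓ + (2 * n - 1) - j) % (2 * n - 1), hmod _⟩
    (min u v, max u v)

/-- The bilinear that belongs to pair number `j` of layer `ℓ`. -/
def layerBilinear {n : ℕ} (ℓ : Fin (2 * n - 1)) (j : Fin n) : Op n :=
  bilinear (layerPair ℓ j).1 (layerPair ℓ j).2

/-- The spectral projector `(1 + s B) / 2` of a Hermitian involution `B`, for `s = ±1`. -/
def signProj {n : ℕ} (B : Op n) (s : ℤˣ) : Op n :=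
  (1 / 2 : ℂ) • (1 + ((s : ℤ) : ℂ) • B)

/-- The joint spectral projector of the bilinears of layer `ℓ` for the sign vector `x`. -/
def layerProj {n : ℕ} (ℓ : Fin (2 * n - 1)) (x : Fin n → ℤˣ) : Op n :=
  (List.ofFn fun j => signProj (layerBilinear ℓ j) (x j)).prod

/-! #### The joint spectral projectors of a layer form a measurement -/

lemma tensorOp_mul {n : ℕ} (P Q : Fin n → Matrix (Fin 2) (Fin 2) ℂ) :
    tensorOp P * tensorOp Q = tensorOp fun k => P k * Q k := by
  ext x y
  simp only [tensorOp, Matrix.mul_apply, Matrix.of_apply]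
  rw [Finset.prod_univ_sum, Fintype.piFinset_univ]
  exact Finset.sum_congr rfl fun z _ => Finset.prod_mul_distrib.symm

lemma tensorOp_smul {n : ℕ} (s : Fin n → ℂ) (P : Fin n → Matrix (Fin 2) (Fin 2) ℂ) :
    tensorOp (fun k => s k • P k) = (∏ k, s k) • tensorOp P := by
  ext x y
  simp [tensorOp, Finset.prod_mul_distrib]

lemma tensorOp_one {n : ℕ} : tensorOp (fun _ : Fin n => 1) = 1 := by
  ext x y
  simp only [tensorOp, Matrix.of_apply, Matrix.one_apply]
  by_cases h : x = y
  · simp [h]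
  · obtain ⟨k, hk⟩ := Function.ne_iff.mp h
    rw [if_neg h]
    exact Finset.prod_eq_zero (Finset.mem_univ k) (by simp [hk])

lemma tensorOp_conjTranspose {n : ℕ} (P : Fin n → Matrix (Fin 2) (Fin 2) ℂ) :
    (tensorOp P)ᴴ = tensorOp fun k => (P k)ᴴ := by
  ext x y
  simp [tensorOp, Matrix.conjTranspose_apply]

lemma jwFactor_sq (a k : ℕ) : jwFactor a k * jwFactor a k = 1 := by
  unfold jwFactor
  split_ifs <;> ext i j <;> fin_cases i <;> fin_cases j <;>
    simp [pauliX, pauliY, pauliZ, Matrix.mul_apply]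

lemma jwFactor_conjTranspose (a k : ℕ) : (jwFactor a k)ᴴ = jwFactor a k := by
  unfold jwFactor
  split_ifs <;> ext i j <;> fin_cases i <;> fin_cases j <;>
    simp [pauliX, pauliY, pauliZ, Matrix.conjTranspose_apply]

lemma jwFactor_swap (a b k : ℕ) (hab : a < b) :
    jwFactor b k * jwFactor a k =
      (if k = a / 2 then (-1 : ℂ) else 1) • (jwFactor a k * jwFactor b k) := by
  have h2 : a / 2 ≤ b / 2 := Nat.div_le_div_right hab.le
  unfold jwFactor
  split_ifs <;> first
    | omega
    | (ext i j; fin_cases i <;> fin_cases j <;>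
        simp [pauliX, pauliY, pauliZ, Matrix.mul_apply])

lemma majorana_sq {n : ℕ} (a : Fin (2 * n)) : majorana a * majorana a = 1 := by
  simp [majorana, tensorOp_mul, jwFactor_sq, tensorOp_one]

lemma majorana_conjTranspose {n : ℕ} (a : Fin (2 * n)) : (majorana a)ᴴ = majorana a := by
  simp [majorana, tensorOp_conjTranspose, jwFactor_conjTranspose]

lemma majorana_swap {n : ℕ} {a b : Fin (2 * n)} (hab : a ≠ b) :
    majorana b * majorana a = -(majorana a * majorana b) := by
  have key : ∀ a b : Fin (2 * n), a < b →
      majorana b * majorana a = -(majorana a * majorana b) := by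
    intro a b h
    have ha : (a : ℕ) / 2 < n := by omega
    simp only [majorana, tensorOp_mul]
    rw [show (fun k : Fin n => jwFactor b k * jwFactor a k) = fun k : Fin n =>
      (if (k : ℕ) = (a : ℕ) / 2 then (-1 : ℂ) else 1) • (jwFactor a k * jwFactor b k) from
      funext fun k => jwFactor_swap a b k h, tensorOp_smul]
    have : (∏ k : Fin n, if (k : ℕ) = (a : ℕ) / 2 then (-1 : ℂ) else 1) = -1 := by
      rw [Finset.prod_eq_single (⟨(a : ℕ) / 2, ha⟩ : Fin n)]
      · simp
      · intro k _ hk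
        rw [if_neg]
        intro h'
        exact hk (Fin.ext h')
      · simp
    rw [this, neg_one_smul]
  rcases lt_or_gt_of_ne hab with h | h
  · exact key a b h
  · rw [key b a h, neg_neg]

lemma bilinear_sq {n : ℕ} {a b : Fin (2 * n)} (hab : a ≠ b) :
    bilinear a b * bilinear a b = 1 := by
  have h : majorana a * majorana b * (majorana a * majorana b) = -1 := by
    calc majorana a * majorana b * (majorana a * majorana b)
        = majorana a * (majorana b * majorana a) * majorana b := by simp only [mul_assoc]
      _ = -(majorana a * majorana a * (majorana b * majorana b)) := by
          rw [majorana_swap hab]; simp only [mul_neg, neg_mul, mul_assoc]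
      _ = -1 := by rw [majorana_sq, majorana_sq, mul_one]
  simp [bilinear, h, smul_smul]

lemma bilinear_conjTranspose {n : ℕ} {a b : Fin (2 * n)} (hab : a ≠ b) :
    (bilinear a b)ᴴ = bilinear a b := by
  simp [bilinear, Matrix.conjTranspose_smul, Matrix.conjTranspose_mul, majorana_conjTranspose,
    majorana_swap hab]

lemma bilinear_commute {n : ℕ} {a b c d : Fin (2 * n)} (hac : a ≠ c) (had : a ≠ d) (hbc : b ≠ c)
    (hbd : b ≠ d) : Commute (bilinear a b) (bilinear c d) := by
  have h : Commute (majorana a * majorana b) (majorana c * majorana d) := by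
    change majorana a * majorana b * (majorana c * majorana d) =
      majorana c * majorana d * (majorana a * majorana b)
    calc majorana a * majorana b * (majorana c * majorana d)
        = majorana a * (majorana b * majorana c) * majorana d := by simp only [mul_assoc]
      _ = -(majorana a * majorana c * (majorana b * majorana d)) := by
          rw [majorana_swap hbc.symm]; simp only [mul_neg, neg_mul, mul_assoc]
      _ = -(majorana c * (majorana a * majorana d) * majorana b) := by
          rw [majorana_swap hac.symm, majorana_swap hbd.symm]
          simp only [mul_neg, neg_mul, mul_assoc, neg_neg]
      _ = majorana c * majorana d * (majorana a * majorana b) := by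
          rw [majorana_swap had.symm]; simp only [mul_neg, neg_mul, mul_assoc, neg_neg]
  exact (h.smul_left _).smul_right _

lemma nat_mod_cases {m x : ℕ} (h : x < 2 * m) :
    (x < m ∧ x % m = x) ∨ (m ≤ x ∧ x % m = x - m) := by
  rcases lt_or_ge x m with h1 | h1
  · exact Or.inl ⟨h1, Nat.mod_eq_of_lt h1⟩
  · refine Or.inr ⟨h1, ?_⟩
    rw [Nat.mod_eq_sub_mod h1, Nat.mod_eq_of_lt (by omega)]

lemma layerPair_lt {n : ℕ} (ℓ : Fin (2 * n - 1)) (j : Fin n) :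
    (layerPair ℓ j).1 < (layerPair ℓ j).2 := by
  have hj := j.2
  have hl := ℓ.2
  unfold layerPair
  split_ifs with h
  · exact Fin.mk_lt_mk.mpr hl
  · simp only [min_lt_max]
    intro h'
    rw [Fin.mk.injEq] at h'
    rcases nat_mod_cases (m := 2 * n - 1) (x := ℓ + j) (by omega) with h1 | h1 <;>
    rcases nat_mod_cases (m := 2 * n - 1) (x := ℓ + (2 * n - 1) - j) (by omega) with h2 | h2 <;>
    omega

lemma layerPair_val {n : ℕ} (ℓ : Fin (2 * n - 1)) (j : Fin n) :
    ((j : ℕ) = 0 ∧ ((layerPair ℓ j).1 : ℕ) = ℓ ∧ ((layerPair ℓ j).2 : ℕ) = 2 * n - 1) ∨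
    ((j : ℕ) ≠ 0 ∧ ∃ u v : ℕ, (u = ℓ + j ∧ u < 2 * n - 1 ∨ u + (2 * n - 1) = ℓ + j) ∧
      (v + j = ℓ + (2 * n - 1) ∧ v < 2 * n - 1 ∨ v + j = ℓ) ∧
      (((layerPair ℓ j).1 : ℕ) = u ∧ ((layerPair ℓ j).2 : ℕ) = v ∨
        ((layerPair ℓ j).1 : ℕ) = v ∧ ((layerPair ℓ j).2 : ℕ) = u)) := by
  have hj := j.2
  have hl := ℓ.2
  by_cases h : (j : ℕ) = 0
  · exact Or.inl ⟨h, by simp [layerPair, h], by simp [layerPair, h]⟩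
  · refine Or.inr ⟨h, (ℓ + j) % (2 * n - 1), (ℓ + (2 * n - 1) - j) % (2 * n - 1), ?_, ?_, ?_⟩
    · rcases nat_mod_cases (m := 2 * n - 1) (x := ℓ + j) (by omega) with h1 | h1 <;> omega
    · rcases nat_mod_cases (m := 2 * n - 1) (x := ℓ + (2 * n - 1) - j) (by omega) with
        h1 | h1 <;> omega
    · simp only [layerPair, h, if_false]
      rcases le_total ((ℓ + j : ℕ) % (2 * n - 1)) ((ℓ + (2 * n - 1) - j : ℕ) % (2 * n - 1)) with
        h1 | h1
      · left; simp [h1]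
      · right; simp [h1]

lemma layerPair_disjoint {n : ℕ} (ℓ : Fin (2 * n - 1)) {i j : Fin n} (hij : i ≠ j) :
    (layerPair ℓ i).1 ≠ (layerPair ℓ j).1 ∧ (layerPair ℓ i).1 ≠ (layerPair ℓ j).2 ∧
    (layerPair ℓ i).2 ≠ (layerPair ℓ j).1 ∧ (layerPair ℓ i).2 ≠ (layerPair ℓ j).2 := by
  have hi := i.2
  have hj := j.2
  have hl := ℓ.2
  have hij' : (i : ℕ) ≠ j := fun h => hij (Fin.ext h)
  simp only [ne_eq, Fin.ext_iff]
  have key : ∀ a b c d : ℕ, a ≠ c → a ≠ d → b ≠ c → b ≠ d → ∀ p q r s : ℕ,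
      (p = a ∧ q = b ∨ p = b ∧ q = a) → (r = c ∧ s = d ∨ r = d ∧ s = c) →
      ¬p = r ∧ ¬p = s ∧ ¬q = r ∧ ¬q = s := by omega
  rcases layerPair_val ℓ i with ⟨hi0, h1, h2⟩ | ⟨hi0, u, v, hu, hv, h1⟩ <;>
  rcases layerPair_val ℓ j with ⟨hj0, h3, h4⟩ | ⟨hj0, u', v', hu', hv', h3⟩
  · omega
  · exact key _ _ u' v' (by omega) (by omega) (by omega) (by omega) _ _ _ _ (Or.inl ⟨h1, h2⟩) h3
  · exact key u v _ _ (by omega) (by omega) (by omega) (by omega) _ _ _ _ h1 (Or.inl ⟨h3, h4⟩)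
  · exact key u v u' v' (by omega) (by omega) (by omega) (by omega) _ _ _ _ h1 h3

lemma layerBilinear_commute {n : ℕ} (ℓ : Fin (2 * n - 1)) (i j : Fin n) :
    Commute (layerBilinear ℓ i) (layerBilinear ℓ j) := by
  by_cases h : i = j
  · rw [h]
  · obtain ⟨h1, h2, h3, h4⟩ := layerPair_disjoint ℓ h
    exact bilinear_commute h1 h2 h3 h4

lemma unit_cast_sq (s : ℤˣ) : ((s : ℤ) : ℂ) * ((s : ℤ) : ℂ) = 1 := by
  rcases Int.units_eq_one_or s with rfl | rfl <;> simp

lemma signProj_mul_self {n : ℕ} {B : Op n} (hB : B * B = 1) (s : ℤˣ) :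
    signProj B s * signProj B s = signProj B s := by
  unfold signProj
  rw [smul_mul_smul_comm, mul_add, add_mul, add_mul, smul_mul_smul_comm, hB, unit_cast_sq]
  simp only [one_mul, mul_one, one_smul]
  rw [show (1 : Op n) + ((s : ℤ) : ℂ) • B + (((s : ℤ) : ℂ) • B + 1)
    = (2 : ℂ) • (1 + ((s : ℤ) : ℂ) • B) by rw [two_smul]; abel, smul_smul]
  norm_num

lemma signProj_conjTranspose {n : ℕ} {B : Op n} (hB : Bᴴ = B) (s : ℤˣ) :
    (signProj B s)ᴴ = signProj B s := by
  simp [signProj, Matrix.conjTranspose_smul, hB]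

lemma signProj_commute {n : ℕ} {B C : Op n} (h : Commute B C) (s t : ℤˣ) :
    Commute (signProj B s) (signProj C t) := by
  unfold signProj
  exact ((((Commute.one_left _).add_left
    (((Commute.one_right B).add_right (h.smul_right _)).smul_left _)).smul_left _).smul_right _)

lemma signProj_sum {n : ℕ} (B : Op n) : ∑ s : ℤˣ, signProj B s = 1 := by
  rw [show (Finset.univ : Finset ℤˣ) = {1, -1} from rfl, Finset.sum_pair (by decide)]
  unfold signProj
  rw [← smul_add, show (1 : Op n) + (((1 : ℤˣ) : ℤ) : ℂ) • B + (1 + (((-1 : ℤˣ) : ℤ) : ℂ) • B)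
    = (2 : ℂ) • 1 by rw [two_smul]; simp; abel, smul_smul]
  norm_num

lemma sum_prod_ofFn {R : Type} [Semiring R] {Ω : Type} [Fintype Ω] :
    ∀ {n : ℕ} (f : Fin n → Ω → R),
      ∑ x : Fin n → Ω, (List.ofFn fun j => f j (x j)).prod = (List.ofFn fun j => ∑ s, f j s).prod
  | 0, f => by simp
  | n + 1, f => by
    rw [← (Fin.consEquiv fun _ => Ω).sum_comp, Fintype.sum_prod_type]
    simp only [List.ofFn_succ, List.prod_cons, Fin.consEquiv_apply, Fin.cons_zero, Fin.cons_succ]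
    rw [← sum_prod_ofFn fun j => f j.succ, Finset.sum_mul_sum]

lemma proj_prod {n : ℕ} : ∀ L : List (Op n), (∀ P ∈ L, P * P = P ∧ Pᴴ = P) →
    (∀ P ∈ L, ∀ Q ∈ L, Commute P Q) → L.prod * L.prod = L.prod ∧ L.prodᴴ = L.prod
  | [], _, _ => by simp
  | P :: L, h, hc => by
    obtain ⟨h1, h2⟩ := proj_prod L (fun Q hQ => h Q (by simp [hQ]))
      (fun Q hQ R hR => hc Q (by simp [hQ]) R (by simp [hR]))
    have hcomm : Commute P L.prod :=
      Commute.list_prod_right _ _ fun Q hQ => hc P (by simp) Q (by simp [hQ])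
    obtain ⟨h3, h4⟩ := h P (by simp)
    rw [List.prod_cons]
    refine ⟨?_, ?_⟩
    · rw [mul_assoc, ← mul_assoc L.prod, ← hcomm.eq, mul_assoc, h1, ← mul_assoc, h3]
    · rw [Matrix.conjTranspose_mul, h2, h4, hcomm.eq]

/-- The joint measurement of the `n` commuting bilinears of layer `ℓ`. -/
def layerMeasurement {n : ℕ} (ℓ : Fin (2 * n - 1)) : POVM n (Fin n → ℤˣ) where
  effect := layerProj ℓ
  posSemidef x := by
    obtain ⟨h1, h2⟩ := proj_prod (List.ofFn fun j => signProj (layerBilinear ℓ j) (x j))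
      (by
        intro P hP
        obtain ⟨j, rfl⟩ := (List.mem_ofFn' _ _).mp hP
        exact ⟨signProj_mul_self (bilinear_sq (layerPair_lt ℓ j).ne) _,
          signProj_conjTranspose (bilinear_conjTranspose (layerPair_lt ℓ j).ne) _⟩)
      (by
        intro P hP Q hQ
        obtain ⟨i, rfl⟩ := (List.mem_ofFn' _ _).mp hP
        obtain ⟨j, rfl⟩ := (List.mem_ofFn' _ _).mp hQ
        exact signProj_commute (layerBilinear_commute ℓ i j) _ _)
    have h3 : layerProj ℓ x = (layerProj ℓ x)ᴴ * layerProj ℓ x := by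
      unfold layerProj
      rw [h2, h1]
    rw [h3]
    exact Matrix.posSemidef_conjTranspose_mul_self _
  sum_effect := by
    unfold layerProj
    rw [sum_prod_ofFn fun j s => signProj (layerBilinear ℓ j) s]
    simp only [signProj_sum]
    simp

/-! ### The matching protocol -/

/-- The U-statistic `(M choose 2)⁻¹ ∑_{r < s} ∑_e X_r^e X_s^e` of one layer. -/
def layerEstimate {n M : ℕ} (X : Fin M → Fin n → ℤˣ) : ℝ :=
  ((M.choose 2 : ℕ) : ℝ)⁻¹ *
    ∑ r : Fin M, ∑ s ∈ Finset.Ioi r, ∑ e : Fin n, ((X r e : ℤ) : ℝ) * ((X s e : ℤ) : ℝ)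

/-- One run: `M` shots of the joint measurement of each of the `2n - 1` layers. -/
def runMeasurement (n M : ℕ) : Fin (2 * n - 1) × Fin M → POVM n (Fin n → ℤˣ) :=
  fun p => layerMeasurement p.1

/-- The estimate of `FAF_1` from the outcomes of one run. -/
def fafEstimate {n M : ℕ} (X : Fin (2 * n - 1) × Fin M → Fin n → ℤˣ) : ℝ :=
  n - ∑ ℓ : Fin (2 * n - 1), layerEstimate fun r => X (ℓ, r)

/-- The median of an odd number of reals: the middle one after sorting. -/
def median {k : ℕ} (v : Fin (2 * k + 1) → ℝ) : ℝ := v (Tuple.sort v ⟨k, by omega⟩)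

/-- The matching protocol: `2k + 1` independent runs; accept iff the median of the estimates of
`FAF_1` from the runs is at most `τ`. -/
def matchingProtocol (n M k : ℕ) (τ : ℝ) : SingleCopyProtocol n where
  Shot := Fin (2 * k + 1) × (Fin (2 * n - 1) × Fin M)
  Outcome := Fin n → ℤˣ
  measurement p := runMeasurement n M p.2
  accept := {ω | median (fun i => fafEstimate fun p => ω (i, p)) ≤ τ}

end

end FermionTest

/-! The argument has three ingredients: an unbiased estimator, a lower bound on the antiflatness
away from the Gaussian states, and amplification by a median.

Estimator. Since `Γ` is antisymmetric, `FAF₁ = n - ∑_{a<b} Γ_ab²`, and the outcome for the pair `e`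
in its layer has mean `Γ_e`. The product of two independent outcomes is therefore unbiased for
`Γ_e²`, and the layers cover every pair once (`existsUnique_layerPair`). The Hoeffding decomposition
(`uStatistic_eq`) writes the fluctuation as a linear part plus a degenerate part. Independence
removes the covariances between different shots in the first and between different pairs of shots in
the second. The linear part costs `O(n ∑ Γ_e² / M)`, which is `O(n² / M)` because `FAF₁ ≥ 0` means
`∑ Γ_e² ≤ n`. The degenerate part costs `O(n² / M²)` for each of the `2n - 1` layers.

Gap. An orthogonal change of modes makes `Γ` block diagonal, with `n` commuting bilinears of
expectations `c_j ∈ [0, 1]` and `FAF₁ = ∑ (1 - c_j²)` (`exists_mode_decomposition`). By the union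
bound the joint `+1` projector `P` has weight `F ≥ 1 - ∑ (1 - c_j) / 2 ≥ 1 - FAF₁ / 2`. If `F > 0`,
the normalization of `Pψ` is a pure Gaussian state of overlap `F` with `ψ`, so its squared trace
distance to `ψ` is at most `1 - F` (`exists_gaussian_overlap`, `traceDist_ketbra_sq_le`). Hence
`FAF₁ ≥ 2 ε²` at distance at least `ε`, while `FAF₁ = 0` on Gaussian states (`two_mul_sq_le_faf`,
`faf_one_of_gaussian`).

Amplification. The threshold `ε²` is the middle of this gap. With `M` of order `n² / ε⁴`, Chebyshev
bounds the failure of one run by `1/15`, and `productExp_majority` makes the median fail with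
probability at most `4⁻ᵏ`. Taking `k` of order `log (1/δ)` gives the shot count. -/

namespace FermionTest

noncomputable section

/-! ### Expectations under finite product weights -/

section ProductExpectation

variable {ι Ω : Type} [Fintype ι] [DecidableEq ι] [Fintype Ω]

/-- The expectation of `f` when the coordinates are independent with weights `w i`. -/
def productExp (w : ι → Ω → ℝ) (f : (ι → Ω) → ℝ) : ℝ := ∑ ω, (∏ i, w i (ω i)) * f ω

lemma expectation_eq_productExp {n : ℕ} (E : ι → POVM n Ω) (ρ : Op n) (f : (ι → Ω) → ℝ) :
    expectation E ρ f = productExp (fun i => (E i).prob ρ) f := rfl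

lemma productExp_add (w : ι → Ω → ℝ) (f g : (ι → Ω) → ℝ) :
    productExp w (fun ω => f ω + g ω) = productExp w f + productExp w g := by
  simp [productExp, mul_add, Finset.sum_add_distrib]

lemma productExp_const_mul (w : ι → Ω → ℝ) (c : ℝ) (f : (ι → Ω) → ℝ) :
    productExp w (fun ω => c * f ω) = c * productExp w f := by
  simp only [productExp, Finset.mul_sum]
  exact Finset.sum_congr rfl fun ω _ => by ring

lemma productExp_sum {κ : Type*} (s : Finset κ) (w : ι → Ω → ℝ) (f : κ → (ι → Ω) → ℝ) :
    productExp w (fun ω => ∑ p ∈ s, f p ω) = ∑ p ∈ s, productExp w (f p) := by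
  simp only [productExp, Finset.mul_sum]
  exact Finset.sum_comm

lemma productExp_mono {w : ι → Ω → ℝ} (hw : ∀ i x, 0 ≤ w i x) {f g : (ι → Ω) → ℝ}
    (h : ∀ ω, f ω ≤ g ω) : productExp w f ≤ productExp w g :=
  Finset.sum_le_sum fun ω _ =>
    mul_le_mul_of_nonneg_left (h ω) (Finset.prod_nonneg fun i _ => hw i _)

lemma productExp_prod (w g : ι → Ω → ℝ) :
    productExp w (fun ω => ∏ i, g i (ω i)) = ∏ i, ∑ x, w i x * g i x := by
  rw [Finset.prod_univ_sum, Fintype.piFinset_univ]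
  exact Finset.sum_congr rfl fun ω _ => Finset.prod_mul_distrib.symm

lemma productExp_const {w : ι → Ω → ℝ} (hw : ∀ i, ∑ x, w i x = 1) (c : ℝ) :
    productExp w (fun _ => c) = c := by
  have h := productExp_prod w fun _ _ => 1
  simp only [Finset.prod_const_one, mul_one, hw] at h
  have h' := productExp_const_mul w c fun _ => 1
  simpa [h] using h'

/-- Fubini in the coordinate `i`: the hypothesis `hf` says that `f` does not depend on it. Only the
weight at `i` has to be normalized. -/
lemma productExp_eval_mul {w : ι → Ω → ℝ} (i : ι) (hw : ∑ x, w i x = 1) (g : Ω → ℝ)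
    {f : (ι → Ω) → ℝ} (hf : ∀ ω x, f (Function.update ω i x) = f ω) :
    productExp w (fun ω => g (ω i) * f ω) = (∑ x, w i x * g x) * productExp w f := by
  -- The second factor does not involve `h`, so comparing `h = g` with `h = 1` identifies it as the
  -- expectation of `f`.
  have split : ∀ h : Ω → ℝ, productExp w (fun ω => h (ω i) * f ω) =
      (∑ x, w i x * h x) * ∑ η : {j // j ≠ i} → Ω, (∏ j : {j // j ≠ i}, w j (η j)) *
        ∑ y, w i y * f ((Equiv.funSplitAt i Ω).symm (y, η)) := by
    intro h
    unfold productExp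
    rw [← (Equiv.funSplitAt i Ω).symm.sum_comp, Fintype.sum_prod_type, Finset.sum_mul]
    refine Finset.sum_congr rfl fun x _ => ?_
    rw [Finset.mul_sum]
    refine Finset.sum_congr rfl fun η _ => ?_
    have hfx : ∀ y, f ((Equiv.funSplitAt i Ω).symm (y, η)) =
        f ((Equiv.funSplitAt i Ω).symm (x, η)) := by
      intro y
      rw [← hf ((Equiv.funSplitAt i Ω).symm (x, η)) y]
      congr 1
      ext j
      by_cases hj : j = i
      · subst hj; simp [Equiv.funSplitAt]
      · simp [Equiv.funSplitAt, hj]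
    simp only [hfx]
    rw [← Finset.sum_mul, hw, one_mul, Fintype.prod_eq_mul_prod_subtype_ne _ i]
    have : ∀ j : {j // j ≠ i}, (Equiv.funSplitAt i Ω).symm (x, η) j = η j := by
      rintro ⟨j, hj⟩
      simp [Equiv.funSplitAt, hj]
    simp only [this]
    simp [Equiv.funSplitAt]
    ring
  have h1 := split fun _ => 1
  simp only [one_mul, mul_one, hw] at h1
  rw [split g, h1]

lemma productExp_eval {w : ι → Ω → ℝ} (hw : ∀ i, ∑ x, w i x = 1) (i : ι) (g : Ω → ℝ) :
    productExp w (fun ω => g (ω i)) = ∑ x, w i x * g x := by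
  have h := productExp_eval_mul (w := w) i (hw i) g (f := fun _ => 1) (by simp)
  simpa [productExp_const hw] using h

lemma productExp_sq_sum {κ : Type*} [DecidableEq κ] (s : Finset κ) (w : ι → Ω → ℝ)
    (f : κ → (ι → Ω) → ℝ)
    (h : ∀ p ∈ s, ∀ q ∈ s, p ≠ q → productExp w (fun ω => f p ω * f q ω) = 0) :
    productExp w (fun ω => (∑ p ∈ s, f p ω) ^ 2) =
      ∑ p ∈ s, productExp w (fun ω => f p ω ^ 2) := by
  simp only [sq, Finset.sum_mul_sum, productExp_sum]
  refine Finset.sum_congr rfl fun p hp => ?_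
  exact Finset.sum_eq_single_of_mem p hp fun q hq hqp => h p hp q hq hqp.symm

/-- Independence of the runs: currying turns an outcome of all shots into a tuple of outcomes of the
runs, over which the sum of products factorizes. -/
lemma productExp_blocks {κ : Type} [Fintype κ] [DecidableEq κ] (w : ι → Ω → ℝ)
    (g : κ → (ι → Ω) → ℝ) :
    productExp (fun p : κ × ι => w p.2) (fun ω => ∏ i, g i fun p => ω (i, p)) =
      ∏ i, productExp w (g i) := by
  unfold productExp
  rw [Finset.prod_univ_sum, Fintype.piFinset_univ,
    ← (Equiv.curry κ ι Ω).symm.sum_comp]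
  refine Finset.sum_congr rfl fun ω _ => ?_
  rw [Finset.prod_mul_distrib, Fintype.prod_prod_type]
  rfl

/-- Chebyshev's inequality. -/
lemma productExp_chebyshev {w : ι → Ω → ℝ} (hw : ∀ i x, 0 ≤ w i x) (f : (ι → Ω) → ℝ) (m : ℝ)
    {t : ℝ} (ht : 0 < t) {S : Set (ι → Ω)} (hS : ∀ ω ∈ S, t ≤ |f ω - m|) :
    productExp w (S.indicator 1) ≤ productExp w (fun ω => (f ω - m) ^ 2) / t ^ 2 := by
  rw [div_eq_inv_mul, ← productExp_const_mul]
  refine productExp_mono hw fun ω => ?_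
  by_cases h : ω ∈ S
  · rw [Set.indicator_of_mem h, Pi.one_apply, ← div_eq_inv_mul, one_le_div (by positivity),
      ← sq_abs (f ω - m)]
    exact pow_le_pow_left₀ ht.le (hS ω h) 2
  · rw [Set.indicator_of_notMem h]
    positivity

/-- If each of `2k + 1` independent runs fails with probability at most `1 / 15`, then a majority
of them fails with probability at most `4⁻ᵏ`. -/
lemma productExp_majority {w : ι → Ω → ℝ} (hw : ∀ i x, 0 ≤ w i x) (hw1 : ∀ i, ∑ x, w i x = 1)
    (k : ℕ) (S : Set (ι → Ω)) (hS : productExp w (S.indicator 1) ≤ 1 / 15)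
    (T : Set (Fin (2 * k + 1) × ι → Ω))
    (hT : ∀ ω ∈ T, ∃ A : Finset (Fin (2 * k + 1)), k + 1 ≤ A.card ∧
      ∀ i ∈ A, (fun p => ω (i, p)) ∈ S) :
    productExp (fun p : Fin (2 * k + 1) × ι => w p.2) (T.indicator 1) ≤ (1 / 4) ^ k := by
  -- Exponential Markov inequality: each failing run contributes a factor `16`, each other run a
  -- factor `1`. One factor has mean at most `1 + 15/15 = 2`, while on `T` the product is at least
  -- `16 ^ (k + 1)`. The quotient `2 ^ (2k + 1) / 16 ^ (k + 1)` is `4⁻ᵏ / 8`.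
  have hb := productExp_blocks (κ := Fin (2 * k + 1)) w
    fun _ η => 1 + 15 * S.indicator 1 η
  have hone : productExp w (fun η => 1 + 15 * S.indicator 1 η) ≤ 2 := by
    rw [productExp_add, productExp_const_mul, productExp_const hw1]
    linarith
  have hge : ∀ η, (1 : ℝ) ≤ 1 + 15 * S.indicator 1 η := by
    intro η
    have : (0 : ℝ) ≤ S.indicator 1 η := Set.indicator_nonneg (by simp) η
    linarith
  have hnonneg : 0 ≤ productExp w (fun η => 1 + 15 * S.indicator 1 η) := by
    have := productExp_mono hw hge
    rw [productExp_const hw1] at this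
    linarith
  have hmain : productExp (fun p : Fin (2 * k + 1) × ι => w p.2) (T.indicator 1) ≤
      productExp (fun p : Fin (2 * k + 1) × ι => w p.2) (fun ω => ((16 : ℝ) ^ (k + 1))⁻¹ *
        ∏ i, (1 + 15 * S.indicator 1 fun p => ω (i, p))) := by
    have hw' : ∀ (p : Fin (2 * k + 1) × ι) x, 0 ≤ w p.2 x := fun p x => hw p.2 x
    apply productExp_mono hw'
    intro ω
    by_cases h : ω ∈ T
    · obtain ⟨A, hA, hAS⟩ := hT ω h
      rw [Set.indicator_of_mem h, Pi.one_apply, ← div_eq_inv_mul,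
        one_le_div (pow_pos (by norm_num) _)]
      calc (16 : ℝ) ^ (k + 1) ≤ 16 ^ A.card := pow_le_pow_right₀ (by norm_num) hA
        _ = ∏ i ∈ A, (1 + 15 * S.indicator 1 fun p => ω (i, p)) := by
            rw [← Finset.prod_const]
            refine Finset.prod_congr rfl fun i hi => ?_
            rw [Set.indicator_of_mem (hAS i hi), Pi.one_apply]
            norm_num
        _ ≤ ∏ i, (1 + 15 * S.indicator 1 fun p => ω (i, p)) :=
            Finset.prod_le_prod_of_subset_of_one_le (Finset.subset_univ A)
              (fun i _ => le_trans zero_le_one (hge _)) fun i _ _ => hge _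
    · rw [Set.indicator_of_notMem h]
      exact mul_nonneg (by positivity)
        (Finset.prod_nonneg fun i _ => le_trans zero_le_one (hge _))
  refine hmain.trans ?_
  rw [productExp_const_mul, hb, Finset.prod_const, Finset.card_univ, Fintype.card_fin]
  calc ((16 : ℝ) ^ (k + 1))⁻¹ * productExp w (fun η => 1 + 15 * S.indicator 1 η) ^ (2 * k + 1)
      ≤ ((16 : ℝ) ^ (k + 1))⁻¹ * 2 ^ (2 * k + 1) := by gcongr
    _ = (1 / 8) * (1 / 4) ^ k := by
        rw [pow_succ, pow_succ, pow_mul, mul_inv, ← inv_pow]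
        rw [show (16 : ℝ)⁻¹ ^ k * 16⁻¹ * ((2 ^ 2) ^ k * 2) = (1 / 8) * ((16 : ℝ)⁻¹ * 2 ^ 2) ^ k by
          rw [mul_pow]; ring]
        norm_num
    _ ≤ (1 / 4) ^ k := by
        have : (0 : ℝ) ≤ (1 / 4) ^ k := by positivity
        linarith

end ProductExpectation

/-! ### Mean and variance of the U-statistic -/

section UStatistic

/-- Each index lies in `M - 1` pairs: it is the smaller member of some and the larger member of the
others. -/
lemma sum_pairs_add {M : ℕ} (f : Fin M → ℝ) :
    ∑ r, ∑ s ∈ Finset.Ioi r, (f r + f s) = (M - 1) * ∑ r, f r := by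
  have h : ∑ r, ∑ s ∈ Finset.Ioi r, f s = ∑ s, ∑ r ∈ Finset.Iio s, f s :=
    Finset.sum_comm' (by simp)
  simp only [Finset.sum_add_distrib]
  rw [h, Finset.mul_sum, ← Finset.sum_add_distrib]
  refine Finset.sum_congr rfl fun r _ => ?_
  rw [Finset.sum_const, Finset.sum_const, Fin.card_Ioi, Fin.card_Iio, nsmul_eq_mul, nsmul_eq_mul,
    ← add_mul, ← Nat.cast_add, show M - 1 - (r : ℕ) + r = M - 1 by omega,
    Nat.cast_sub (by have := r.2; omega), Nat.cast_one]

lemma sum_pairs_const (M : ℕ) (c : ℝ) :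
    ∑ r : Fin M, ∑ _s ∈ Finset.Ioi r, c = M.choose 2 * c := by
  have h := sum_pairs_add fun _ : Fin M => c / 2
  simp only [add_halves, Finset.sum_const, Finset.card_univ, Fintype.card_fin] at h
  rw [Nat.cast_choose_two]
  simp only [Finset.sum_const] at h ⊢
  rw [h]; simp; ring

variable {L M n : ℕ} {Ω : Type}

/-- The strictly increasing pairs of shots within each of `L` groups of `M` shots. -/
def shotPairs (L M : ℕ) : Finset (Fin L × Fin M × Fin M) :=
  Finset.univ.filter fun p => p.2.1 < p.2.2

lemma sum_shotPairs (f : Fin L → Fin M → Fin M → ℝ) :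
    ∑ p ∈ shotPairs L M, f p.1 p.2.1 p.2.2 = ∑ ℓ, ∑ r, ∑ s ∈ Finset.Ioi r, f ℓ r s := by
  rw [shotPairs, Finset.sum_filter, Fintype.sum_prod_type]
  refine Finset.sum_congr rfl fun ℓ _ => ?_
  rw [Fintype.sum_prod_type]
  refine Finset.sum_congr rfl fun r _ => ?_
  rw [← Finset.sum_filter]
  refine Finset.sum_congr ?_ fun _ _ => rfl
  ext s; simp

/-- The sum over the groups of the U-statistics with kernel `⟨X, X'⟩`. -/
def uStatistic (X : Ω → Fin n → ℝ) (ω : Fin L × Fin M → Ω) : ℝ :=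
  ∑ ℓ, ((M.choose 2 : ℕ) : ℝ)⁻¹ * ∑ r : Fin M, ∑ s ∈ Finset.Ioi r,
    ∑ e, X (ω (ℓ, r)) e * X (ω (ℓ, s)) e

/-- The centered kernel of a pair of shots. -/
def centeredKernel (X : Ω → Fin n → ℝ) (μ : Fin L → Fin n → ℝ) (p : Fin L × Fin M × Fin M)
    (ω : Fin L × Fin M → Ω) : ℝ :=
  ∑ e, (X (ω (p.1, p.2.1)) e - μ p.1 e) * (X (ω (p.1, p.2.2)) e - μ p.1 e)

/-- The linear part of the U-statistic. -/
def linearPart (X : Ω → Fin n → ℝ) (μ : Fin L → Fin n → ℝ) (p : Fin L × Fin M) (x : Ω) : ℝ :=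
  ∑ e, μ p.1 e * (X x e - μ p.1 e)

/-- The Hoeffding decomposition. -/
lemma uStatistic_eq (hM : 2 ≤ M) (X : Ω → Fin n → ℝ) (μ : Fin L → Fin n → ℝ)
    (ω : Fin L × Fin M → Ω) :
    uStatistic X ω = ∑ ℓ, ∑ e, μ ℓ e ^ 2 + (2 / M * ∑ p, linearPart X μ p (ω p) +
      ((M.choose 2 : ℕ) : ℝ)⁻¹ * ∑ p ∈ shotPairs L M, centeredKernel X μ p ω) := by
  have hM' : (2 : ℝ) ≤ M := by exact_mod_cast hM
  have hc : ((M.choose 2 : ℕ) : ℝ) = M * (M - 1) / 2 := Nat.cast_choose_two ℝ M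
  have hc0 : ((M.choose 2 : ℕ) : ℝ) ≠ 0 := by
    rw [hc]; exact ne_of_gt (by apply div_pos (mul_pos _ _) <;> linarith)
  -- Each shot occurs in `M - 1` of the `M.choose 2` pairs, so this is its weight in the linear
  -- part.
  have hlin : (2 : ℝ) / M = ((M.choose 2 : ℕ) : ℝ)⁻¹ * (M - 1) := by
    rw [hc]
    have : (M : ℝ) - 1 ≠ 0 := by linarith
    have : (M : ℝ) ≠ 0 := by linarith
    field_simp
  rw [show (∑ p ∈ shotPairs L M, centeredKernel X μ p ω) = _ from
    sum_shotPairs fun ℓ r s => centeredKernel X μ (ℓ, r, s) ω, Fintype.sum_prod_type, hlin,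
    mul_assoc, ← mul_add, Finset.mul_sum, ← Finset.sum_add_distrib, uStatistic, Finset.mul_sum,
    ← Finset.sum_add_distrib]
  refine Finset.sum_congr rfl fun ℓ _ => ?_
  rw [← sum_pairs_add fun r => linearPart X μ (ℓ, r) (ω (ℓ, r)), ← Finset.sum_add_distrib]
  rw [show ∑ e, μ ℓ e ^ 2 = ((M.choose 2 : ℕ) : ℝ)⁻¹ *
    ∑ r : Fin M, ∑ _s ∈ Finset.Ioi r, ∑ e, μ ℓ e ^ 2 by
      rw [sum_pairs_const, inv_mul_cancel_left₀ hc0], ← mul_add, ← Finset.sum_add_distrib]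
  congr 1
  refine Finset.sum_congr rfl fun r _ => ?_
  rw [← Finset.sum_add_distrib, ← Finset.sum_add_distrib]
  refine Finset.sum_congr rfl fun s _ => ?_
  simp only [linearPart, centeredKernel]
  rw [← Finset.sum_add_distrib, ← Finset.sum_add_distrib, ← Finset.sum_add_distrib]
  -- Entrywise this is `x y = μ² + μ (x - μ) + μ (y - μ) + (x - μ) (y - μ)`.
  refine Finset.sum_congr rfl fun e _ => ?_
  ring

variable {X : Ω → Fin n → ℝ} {μ : Fin L → Fin n → ℝ}

lemma centeredKernel_update {p : Fin L × Fin M × Fin M} {i : Fin L × Fin M}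
    (h1 : i ≠ (p.1, p.2.1)) (h2 : i ≠ (p.1, p.2.2)) (ω : Fin L × Fin M → Ω) (x : Ω) :
    centeredKernel X μ p (Function.update ω i x) = centeredKernel X μ p ω := by
  simp [centeredKernel, Function.update_of_ne h1.symm, Function.update_of_ne h2.symm]

variable [Fintype Ω] {v : Fin L → Ω → ℝ}

lemma sum_linearPart (hv1 : ∀ ℓ, ∑ x, v ℓ x = 1) (hμ : ∀ ℓ e, ∑ x, v ℓ x * X x e = μ ℓ e)
    (p : Fin L × Fin M) : ∑ x, v p.1 x * linearPart X μ p x = 0 := by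
  have h : ∀ e, ∑ x, v p.1 x * (X x e - μ p.1 e) = 0 := fun e => by
    simp only [mul_sub, Finset.sum_sub_distrib, hμ, ← Finset.sum_mul, hv1, one_mul, sub_self]
  simp only [linearPart, Finset.mul_sum]
  rw [Finset.sum_comm]
  refine Finset.sum_eq_zero fun e _ => ?_
  rw [← mul_zero (μ p.1 e), ← h e, Finset.mul_sum]
  exact Finset.sum_congr rfl fun x _ => by ring

/-- With the other shots fixed, shot `i` enters every summand of the kernel through one centered
factor, which averages to zero. This degeneracy removes both the mean of the kernel and the
covariances of different pairs. -/
lemma centeredKernel_orthogonal (hv1 : ∀ ℓ, ∑ x, v ℓ x = 1)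
    (hμ : ∀ ℓ e, ∑ x, v ℓ x * X x e = μ ℓ e) {p : Fin L × Fin M × Fin M} (i : Fin L × Fin M)
    (hp : p.2.1 ≠ p.2.2) (hi : i = (p.1, p.2.1) ∨ i = (p.1, p.2.2))
    {f : (Fin L × Fin M → Ω) → ℝ} (hf : ∀ ω x, f (Function.update ω i x) = f ω) :
    productExp (fun p : Fin L × Fin M => v p.1) (fun ω => centeredKernel X μ p ω * f ω) = 0 := by
  have h : ∀ e, ∑ x, v p.1 x * (X x e - μ p.1 e) = 0 := fun e => by
    simp only [mul_sub, Finset.sum_sub_distrib, hμ, ← Finset.sum_mul, hv1, one_mul, sub_self]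
  simp only [centeredKernel, Finset.sum_mul]
  rw [productExp_sum]
  refine Finset.sum_eq_zero fun e _ => ?_
  rcases hi with rfl | rfl
  · have := productExp_eval_mul (w := fun p : Fin L × Fin M => v p.1) (p.1, p.2.1) (hv1 _)
      (fun x => X x e - μ p.1 e)
      (f := fun ω => (X (ω (p.1, p.2.2)) e - μ p.1 e) * f ω) (by
        intro ω x
        simp only [hf]
        rw [Function.update_of_ne (by simp [hp.symm])])
    simp only [← mul_assoc] at this
    rw [this, h, zero_mul]
  · have := productExp_eval_mul (w := fun p : Fin L × Fin M => v p.1) (p.1, p.2.2) (hv1 _)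
      (fun x => X x e - μ p.1 e)
      (f := fun ω => (X (ω (p.1, p.2.1)) e - μ p.1 e) * f ω) (by
        intro ω x
        simp only [hf]
        rw [Function.update_of_ne (by simp [hp])])
    simp only [← mul_assoc] at this
    simp only [mul_comm (X (_ : Ω) e - μ p.1 e) (X _ e - μ p.1 e)] at this ⊢
    rw [h, zero_mul] at this
    rw [← this]

lemma productExp_linear (hv1 : ∀ ℓ, ∑ x, v ℓ x = 1)
    (hμ : ∀ ℓ e, ∑ x, v ℓ x * X x e = μ ℓ e) :
    productExp (fun p : Fin L × Fin M => v p.1) (fun ω => ∑ p, linearPart X μ p (ω p)) = 0 := by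
  rw [productExp_sum]
  refine Finset.sum_eq_zero fun p _ => ?_
  rw [productExp_eval (w := fun p : Fin L × Fin M => v p.1) (fun p => hv1 p.1) p,
    sum_linearPart hv1 hμ]

lemma productExp_kernel (hv1 : ∀ ℓ, ∑ x, v ℓ x = 1)
    (hμ : ∀ ℓ e, ∑ x, v ℓ x * X x e = μ ℓ e) :
    productExp (fun p : Fin L × Fin M => v p.1)
      (fun ω => ∑ p ∈ shotPairs L M, centeredKernel X μ p ω) = 0 := by
  rw [productExp_sum]
  refine Finset.sum_eq_zero fun p hp => ?_
  have := centeredKernel_orthogonal hv1 hμ (p := p) _ (Finset.mem_filter.mp hp).2.ne (Or.inl rfl)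
    (f := fun _ => 1) (by simp)
  simpa using this

lemma productExp_uStatistic (hM : 2 ≤ M) (hv1 : ∀ ℓ, ∑ x, v ℓ x = 1)
    (hμ : ∀ ℓ e, ∑ x, v ℓ x * X x e = μ ℓ e) :
    productExp (fun p : Fin L × Fin M => v p.1) (uStatistic X) = ∑ ℓ, ∑ e, μ ℓ e ^ 2 := by
  rw [show uStatistic X = _ from funext fun ω => uStatistic_eq hM X μ ω, productExp_add,
    productExp_add, productExp_const_mul, productExp_const_mul, productExp_linear hv1 hμ,
    productExp_kernel hv1 hμ, productExp_const (w := fun p : Fin L × Fin M => v p.1) fun p => hv1 p.1]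
  ring

/-- Different shots are independent and centered, so only the diagonal survives. The variance of
`⟨μ, X⟩` is at most its second moment, which Cauchy–Schwarz bounds by `n ‖μ‖²` since `‖X‖² = n`.
Keeping `‖μ‖²` here, rather than bounding it by `n` in each layer, is what later saves a factor of
order `n`. -/
lemma productExp_linear_sq (hv : ∀ ℓ x, 0 ≤ v ℓ x) (hv1 : ∀ ℓ, ∑ x, v ℓ x = 1)
    (hμ : ∀ ℓ e, ∑ x, v ℓ x * X x e = μ ℓ e) (hX : ∀ x e, X x e ^ 2 = 1) :
    productExp (fun p : Fin L × Fin M => v p.1) (fun ω => (∑ p, linearPart X μ p (ω p)) ^ 2) ≤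
      M * n * ∑ ℓ, ∑ e, μ ℓ e ^ 2 := by
  rw [productExp_sq_sum]
  · have key : ∀ p : Fin L × Fin M, productExp (fun p : Fin L × Fin M => v p.1)
        (fun ω => linearPart X μ p (ω p) ^ 2) ≤ n * ∑ e, μ p.1 e ^ 2 := by
      intro p
      rw [productExp_eval (w := fun p : Fin L × Fin M => v p.1) (fun p => hv1 p.1) p
        fun x => linearPart X μ p x ^ 2]
      have hmean : ∑ x, v p.1 x * (∑ e, μ p.1 e * X x e) = ∑ e, μ p.1 e ^ 2 := by
        simp only [Finset.mul_sum]
        rw [Finset.sum_comm]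
        refine Finset.sum_congr rfl fun e _ => ?_
        rw [sq]
        nth_rewrite 3 [← hμ]
        rw [Finset.mul_sum]
        exact Finset.sum_congr rfl fun x _ => by ring
      set m := ∑ e, μ p.1 e ^ 2 with hm
      have hlp : ∀ x, linearPart X μ p x = (∑ e, μ p.1 e * X x e) - m := by
        intro x
        rw [hm, ← Finset.sum_sub_distrib]
        exact Finset.sum_congr rfl fun e _ => by ring
      have hvar : ∑ x, v p.1 x * linearPart X μ p x ^ 2 =
          ∑ x, v p.1 x * (∑ e, μ p.1 e * X x e) ^ 2 - m ^ 2 := by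
        calc _ = ∑ x, (v p.1 x * (∑ e, μ p.1 e * X x e) ^ 2 -
              (2 * m) * (v p.1 x * (∑ e, μ p.1 e * X x e)) + m ^ 2 * v p.1 x) :=
              Finset.sum_congr rfl fun x _ => by rw [hlp]; ring
          _ = _ := by
              rw [Finset.sum_add_distrib, Finset.sum_sub_distrib, ← Finset.mul_sum,
                ← Finset.mul_sum, hmean, hv1]
              ring
      have hcs : ∀ x, (∑ e, μ p.1 e * X x e) ^ 2 ≤ n * m := by
        intro x
        have := Finset.sum_mul_sq_le_sq_mul_sq Finset.univ (μ p.1) (X x)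
        simp only [hX, Finset.sum_const, Finset.card_univ, Fintype.card_fin, nsmul_eq_mul,
          mul_one] at this
        linarith
      rw [hvar]
      calc _ ≤ ∑ x, v p.1 x * (∑ e, μ p.1 e * X x e) ^ 2 := by linarith [sq_nonneg m]
        _ ≤ ∑ x, v p.1 x * (n * m) :=
            Finset.sum_le_sum fun x _ => mul_le_mul_of_nonneg_left (hcs x) (hv _ _)
        _ = n * m := by rw [← Finset.sum_mul, hv1, one_mul]
    refine (Finset.sum_le_sum fun p _ => key p).trans (le_of_eq ?_)
    rw [Fintype.sum_prod_type, Finset.mul_sum]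
    refine Finset.sum_congr rfl fun ℓ _ => ?_
    simp
    ring
  · intro p _ q _ hpq
    rw [productExp_eval_mul (w := fun p : Fin L × Fin M => v p.1) p (hv1 _)
      (f := fun ω => linearPart X μ q (ω q)), sum_linearPart hv1 hμ, zero_mul]
    intro ω x
    rw [Function.update_of_ne hpq.symm]

/-- Different pairs of shots are orthogonal, and each kernel is a sum of `n` terms of size at most
`2 * 2`, whence the `16 n²` per pair. -/
lemma productExp_kernel_sq (hv : ∀ ℓ x, 0 ≤ v ℓ x) (hv1 : ∀ ℓ, ∑ x, v ℓ x = 1)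
    (hμ : ∀ ℓ e, ∑ x, v ℓ x * X x e = μ ℓ e) (hX : ∀ x e, X x e ^ 2 = 1) :
    productExp (fun p : Fin L × Fin M => v p.1)
      (fun ω => (∑ p ∈ shotPairs L M, centeredKernel X μ p ω) ^ 2) ≤
      L * (M.choose 2 * (16 * (n : ℝ) ^ 2)) := by
  have habs : ∀ x e, |X x e| = 1 := fun x e => by
    rw [← abs_one, ← sq_eq_sq_iff_abs_eq_abs, hX, one_pow]
  have hμabs : ∀ ℓ e, |μ ℓ e| ≤ 1 := by
    intro ℓ e
    rw [← hμ, ← hv1 ℓ]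
    refine (Finset.abs_sum_le_sum_abs _ _).trans (Finset.sum_le_sum fun x _ => ?_)
    rw [abs_mul, habs, mul_one, abs_of_nonneg (hv _ _)]
  have hY : ∀ ℓ x e, |X x e - μ ℓ e| ≤ 2 := fun ℓ x e =>
    (abs_sub _ _).trans (by linarith [habs x e, hμabs ℓ e])
  have hK : ∀ (p : Fin L × Fin M × Fin M) ω, centeredKernel X μ p ω ^ 2 ≤ 16 * (n : ℝ) ^ 2 := by
    intro p ω
    have : |centeredKernel X μ p ω| ≤ 4 * n := by
      calc _ ≤ ∑ e : Fin n, |(X (ω (p.1, p.2.1)) e - μ p.1 e) * (X (ω (p.1, p.2.2)) e - μ p.1 e)| :=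
            Finset.abs_sum_le_sum_abs _ _
        _ ≤ ∑ _e : Fin n, (2 * 2 : ℝ) := Finset.sum_le_sum fun e _ => by
            rw [abs_mul]
            exact mul_le_mul (hY _ _ _) (hY _ _ _) (abs_nonneg _) (by norm_num)
        _ = 4 * n := by simp; ring
    rw [← sq_abs]
    calc _ ≤ (4 * (n : ℝ)) ^ 2 := pow_le_pow_left₀ (abs_nonneg _) this 2
      _ = _ := by ring
  rw [productExp_sq_sum]
  · have h : ∀ p ∈ shotPairs L M, productExp (fun p : Fin L × Fin M => v p.1)
        (fun ω => centeredKernel X μ p ω ^ 2) ≤ 16 * (n : ℝ) ^ 2 := by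
      intro p _
      rw [← productExp_const (w := fun p : Fin L × Fin M => v p.1) (fun p => hv1 p.1)
        (16 * (n : ℝ) ^ 2)]
      have hv' : ∀ (p : Fin L × Fin M) x, 0 ≤ v p.1 x := fun p x => hv p.1 x
      exact productExp_mono hv' fun ω => hK p ω
    refine (Finset.sum_le_sum h).trans (le_of_eq ?_)
    rw [show (∑ p ∈ shotPairs L M, 16 * (n : ℝ) ^ 2) = _ from
      sum_shotPairs fun _ _ _ => 16 * (n : ℝ) ^ 2,
      Finset.sum_congr rfl fun ℓ _ => sum_pairs_const M (16 * (n : ℝ) ^ 2)]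
    simp
  · rintro ⟨ℓ, r, s⟩ hp ⟨ℓ', r', s'⟩ hq hpq
    have hp' : r < s := (Finset.mem_filter.mp hp).2
    have hq' : r' < s' := (Finset.mem_filter.mp hq).2
    -- Two different increasing pairs cannot both consist of the same shots, so the first has a shot
    -- that the second lacks, and averaging over that shot gives zero.
    by_cases h1 : ((ℓ, r) : Fin L × Fin M) ≠ (ℓ', r') ∧ ((ℓ, r) : Fin L × Fin M) ≠ (ℓ', s')
    · exact centeredKernel_orthogonal hv1 hμ (ℓ, r) hp'.ne (Or.inl rfl)
        fun ω x => centeredKernel_update h1.1 h1.2 ω x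
    · by_cases h2 : ((ℓ, s) : Fin L × Fin M) ≠ (ℓ', r') ∧ ((ℓ, s) : Fin L × Fin M) ≠ (ℓ', s')
      · exact centeredKernel_orthogonal hv1 hμ (ℓ, s) hp'.ne (Or.inr rfl)
          fun ω x => centeredKernel_update h2.1 h2.2 ω x
      · exfalso
        simp only [ne_eq, Prod.mk.injEq] at h1 h2 hpq
        have : ℓ = ℓ' := by tauto
        subst this
        simp only [true_and] at h1 h2 hpq
        have h1' : r = r' ∨ r = s' := by tauto
        have h2' : s = r' ∨ s = s' := by tauto
        omega

lemma variance_uStatistic_le (hM : 2 ≤ M) (hv : ∀ ℓ x, 0 ≤ v ℓ x) (hv1 : ∀ ℓ, ∑ x, v ℓ x = 1)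
    (hμ : ∀ ℓ e, ∑ x, v ℓ x * X x e = μ ℓ e) (hX : ∀ x e, X x e ^ 2 = 1) :
    productExp (fun p : Fin L × Fin M => v p.1)
      (fun ω => (uStatistic X ω - ∑ ℓ, ∑ e, μ ℓ e ^ 2) ^ 2) ≤
      8 * n / M * (∑ ℓ, ∑ e, μ ℓ e ^ 2) + 128 * L * (n : ℝ) ^ 2 / (M : ℝ) ^ 2 := by
  have hM' : (2 : ℝ) ≤ M := by exact_mod_cast hM
  have hc : ((M.choose 2 : ℕ) : ℝ) = M * (M - 1) / 2 := Nat.cast_choose_two ℝ M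
  set c : ℝ := ((M.choose 2 : ℕ) : ℝ) with hcdef
  -- Here `M ≥ 2` enters, as `M - 1 ≥ M / 2`.
  have hcge : (M : ℝ) ^ 2 / 4 ≤ c := by rw [hc]; nlinarith
  have hc0 : 0 < c := lt_of_lt_of_le (by positivity) hcge
  have hv' : ∀ (p : Fin L × Fin M) x, 0 ≤ v p.1 x := fun p x => hv p.1 x
  have hle := productExp_mono hv' (f := fun ω => (uStatistic X ω - ∑ ℓ, ∑ e, μ ℓ e ^ 2) ^ 2)
    (g := fun ω => 2 * (2 / M) ^ 2 * (∑ p, linearPart X μ p (ω p)) ^ 2 +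
      2 * c⁻¹ ^ 2 * (∑ p ∈ shotPairs L M, centeredKernel X μ p ω) ^ 2) (by
    intro ω
    rw [uStatistic_eq hM X μ ω, add_sub_cancel_left, mul_assoc, mul_assoc, ← mul_pow, ← mul_pow,
      ← mul_add]
    -- The bound `(a + b)² ≤ 2 (a² + b²)` spares the covariance of the two parts, at the cost of a
    -- factor `2`.
    exact add_sq_le)
  refine hle.trans ?_
  rw [productExp_add, productExp_const_mul, productExp_const_mul]
  have h1 := productExp_linear_sq (M := M) hv hv1 hμ hX
  have h2 := productExp_kernel_sq (M := M) hv hv1 hμ hX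
  rw [← hcdef] at h2
  refine add_le_add ?_ ?_
  · calc _ ≤ 2 * (2 / (M : ℝ)) ^ 2 * (M * n * ∑ ℓ, ∑ e, μ ℓ e ^ 2) :=
        mul_le_mul_of_nonneg_left h1 (by positivity)
      _ = _ := by field_simp; ring
  · calc _ ≤ 2 * c⁻¹ ^ 2 * (L * (c * (16 * (n : ℝ) ^ 2))) :=
        mul_le_mul_of_nonneg_left h2 (by positivity)
      _ = 32 * L * (n : ℝ) ^ 2 / c := by field_simp; ring
      _ ≤ 32 * L * (n : ℝ) ^ 2 / ((M : ℝ) ^ 2 / 4) := by gcongr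
      _ = _ := by field_simp; ring

end UStatistic

/-! ### The layers form a decomposition into perfect matchings -/

/-- The pair `{ℓ + j, ℓ - j}` has sum `2 ℓ` modulo the odd number `m = 2n - 1`. As `2` is invertible
there, a pair of residues has exactly one midpoint `ℓ`, and `j` is the distance to it up to sign.
Pairs containing the extra index `m` are those with `j = 0`. -/
lemma existsUnique_layerPair {n : ℕ} {a b : Fin (2 * n)} (hab : a < b) :
    ∃! p : Fin (2 * n - 1) × Fin n, layerPair p.1 p.2 = (a, b) := by
  have hb := b.2
  have hab' : (a : ℕ) < b := hab
  have hex : ∃ (ℓ j : ℕ) (hℓ : ℓ < 2 * n - 1) (hj : j < n),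
      layerPair (⟨ℓ, hℓ⟩ : Fin (2 * n - 1)) (⟨j, hj⟩ : Fin n) = (a, b) := by
    by_cases hb1 : (b : ℕ) = 2 * n - 1
    · refine ⟨a, 0, by omega, by omega, ?_⟩
      ext
      · simp [layerPair]
      · simp [layerPair, hb1]
    · obtain ⟨ℓ, j, hℓ, hj, h⟩ : ∃ ℓ j : ℕ, ℓ < 2 * n - 1 ∧ (1 ≤ j ∧ j < n) ∧
          (ℓ = a + j ∧ ℓ + j = b ∨ ℓ + j = a + (2 * n - 1) ∧ b + j = ℓ ∨
            ℓ + j = a ∧ b + j = ℓ + (2 * n - 1)) := by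
        -- If `a + b = 2c`, the midpoint is `c`. If `a + b = 2c + 1`, it is `c + n` modulo `m`,
        -- because `2 (c + n) = a + b + m`.
        rcases Nat.even_or_odd' ((a : ℕ) + b) with ⟨c, hc | hc⟩
        · exact ⟨c, b - c, by omega, by omega, by omega⟩
        · by_cases hcn : c + n < 2 * n - 1
          · exact ⟨c + n, c + n - b, by omega, by omega, by omega⟩
          · exact ⟨c + n - (2 * n - 1), c + n - b, by omega, by omega, by omega⟩
      refine ⟨ℓ, j, hℓ, hj.2, ?_⟩
      have hv := layerPair_val (⟨ℓ, hℓ⟩ : Fin (2 * n - 1)) (⟨j, hj.2⟩ : Fin n)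
      have hlt : ((layerPair (⟨ℓ, hℓ⟩ : Fin (2 * n - 1)) (⟨j, hj.2⟩ : Fin n)).1 : ℕ) <
        (layerPair (⟨ℓ, hℓ⟩ : Fin (2 * n - 1)) (⟨j, hj.2⟩ : Fin n)).2 := layerPair_lt _ _
      simp only at hv
      rcases hv with ⟨h0, _⟩ | ⟨_, u, v, hu, hv, huv⟩
      · omega
      · have h1 : ((layerPair (⟨ℓ, hℓ⟩ : Fin (2 * n - 1)) (⟨j, hj.2⟩ : Fin n)).1 : ℕ) = a := by
          omega
        have h2 : ((layerPair (⟨ℓ, hℓ⟩ : Fin (2 * n - 1)) (⟨j, hj.2⟩ : Fin n)).2 : ℕ) = b := by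
          omega
        exact Prod.ext (Fin.ext h1) (Fin.ext h2)
  obtain ⟨ℓ, j, hℓ, hj, h⟩ := hex
  refine ⟨(⟨ℓ, hℓ⟩, ⟨j, hj⟩), h, ?_⟩
  rintro ⟨ℓ', j'⟩ h'
  simp only at h h'
  have hv := layerPair_val (⟨ℓ, hℓ⟩ : Fin (2 * n - 1)) (⟨j, hj⟩ : Fin n)
  have hv' := layerPair_val ℓ' j'
  rw [h] at hv
  rw [h'] at hv'
  simp only at hv hv'
  have hj' := j'.2
  have hℓ' := ℓ'.2
  have h1 : (ℓ' : ℕ) = ℓ ∧ (j' : ℕ) = j := by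
    rcases hv with ⟨h0, h1, h2⟩ | ⟨h0, u, v, hu, hv, huv⟩ <;>
    rcases hv' with ⟨h0', h1', h2'⟩ | ⟨h0', u', v', hu', hv', huv'⟩
    · omega
    · omega
    · omega
    · rcases huv with huv | huv <;> rcases huv' with huv' | huv' <;> omega
  exact Prod.ext (Fin.ext h1.1) (Fin.ext h1.2)

/-- A sum over all layers and their pairs is a sum over all increasing pairs. -/
lemma sum_layerPair {n : ℕ} (f : Fin (2 * n) → Fin (2 * n) → ℝ) :
    ∑ ℓ : Fin (2 * n - 1), ∑ j : Fin n, f (layerPair ℓ j).1 (layerPair ℓ j).2 =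
      ∑ a, ∑ b ∈ Finset.Ioi a, f a b := by
  rw [← Fintype.sum_prod_type', Finset.sum_sigma']
  refine Finset.sum_bij (fun p _ => ⟨(layerPair p.1 p.2).1, (layerPair p.1 p.2).2⟩) ?_ ?_ ?_ ?_
  · intro p _
    simpa using layerPair_lt p.1 p.2
  · intro p _ q _ h
    obtain ⟨h1, h2⟩ := Sigma.mk.inj h
    have h2 := eq_of_heq h2
    exact (existsUnique_layerPair (layerPair_lt p.1 p.2)).unique rfl (Prod.ext h1.symm h2.symm)
  · rintro ⟨a, b⟩ h
    obtain ⟨p, hp, _⟩ := existsUnique_layerPair (a := a) (b := b) (by simpa using h)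
    exact ⟨p, Finset.mem_univ _, by simp [hp]⟩
  · intro p _
    rfl

/-! ### Born weights and the covariance matrix -/

/-- For `A = ∑ vᵢ vᵢ*` the trace is `∑ vᵢ* B vᵢ`. -/
lemma trace_mul_re_nonneg {n : ℕ} {A B : Op n} (hA : A.PosSemidef) (hB : B.PosSemidef) :
    0 ≤ (A * B).trace.re := by
  obtain ⟨m, v, rfl⟩ := posSemidef_iff_eq_sum_vecMulVec.mp hA
  rw [Finset.sum_mul, Matrix.trace_sum, Complex.re_sum]
  refine Finset.sum_nonneg fun i _ => ?_
  rw [Matrix.trace_mul_comm, Matrix.mul_vecMulVec, Matrix.trace_vecMulVec, dotProduct_comm]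
  exact (Complex.le_def.mp (hB.dotProduct_mulVec_nonneg (v i))).1

lemma POVM.prob_nonneg {n : ℕ} {Ω : Type} [Fintype Ω] (E : POVM n Ω) {ρ : Op n} (hρ : IsState ρ)
    (x : Ω) : 0 ≤ E.prob ρ x :=
  trace_mul_re_nonneg hρ.1 (E.posSemidef x)

lemma POVM.sum_prob {n : ℕ} {Ω : Type} [Fintype Ω] (E : POVM n Ω) {ρ : Op n} (hρ : IsState ρ) :
    ∑ x, E.prob ρ x = 1 := by
  simp only [POVM.prob]
  rw [← Complex.re_sum, ← Matrix.trace_sum, ← Finset.mul_sum, E.sum_effect, mul_one, hρ.2]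
  simp

lemma covariance_eq {n : ℕ} (ρ : Op n) {a b : Fin (2 * n)} (hab : a ≠ b) :
    covariance ρ a b = (ρ * bilinear a b).trace.re := by
  rw [covariance, Matrix.of_apply, majorana_swap hab, sub_neg_eq_add, ← two_smul ℂ, bilinear,
    Matrix.mul_smul, Matrix.mul_smul, Matrix.trace_smul, Matrix.trace_smul, smul_eq_mul,
    smul_eq_mul, ← mul_assoc]
  congr 2
  ring

lemma covariance_transpose {n : ℕ} (ρ : Op n) : (covariance ρ)ᵀ = -covariance ρ := by
  ext a b
  simp only [covariance, Matrix.transpose_apply, Matrix.of_apply, Matrix.neg_apply]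
  rw [← neg_sub (majorana a * majorana b), Matrix.mul_neg, Matrix.trace_neg, mul_neg,
    Complex.neg_re]

lemma sum_signProj_mul {n : ℕ} (B : Op n) :
    ∑ s : ℤˣ, ((s : ℤ) : ℂ) • signProj B s = B := by
  rw [show (Finset.univ : Finset ℤˣ) = {1, -1} from rfl, Finset.sum_pair (by decide)]
  simp only [signProj, Units.val_one, Units.val_neg, Int.cast_one, Int.cast_neg, one_smul,
    neg_smul, ← sub_eq_add_neg, ← smul_sub]
  rw [show (1 : Op n) + B - (1 - B) = (2 : ℂ) • B by rw [two_smul]; abel, smul_smul]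
  norm_num

lemma prod_ofFn_smul {n : ℕ} : ∀ {k : ℕ} (c : Fin k → ℂ) (P : Fin k → Op n),
    (List.ofFn fun j => c j • P j).prod = (∏ j, c j) • (List.ofFn P).prod
  | 0, _, _ => by simp
  | k + 1, c, P => by
    simp only [List.ofFn_succ, List.prod_cons, Fin.prod_univ_succ]
    rw [prod_ofFn_smul (fun j => c j.succ) fun j => P j.succ, smul_mul_smul_comm]

lemma prod_ofFn_ite {n : ℕ} : ∀ {k : ℕ} (e : Fin k) (P : Op n),
    (List.ofFn fun j => if j = e then P else 1).prod = P
  | k + 1, e, P => by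
    rw [List.ofFn_succ, List.prod_cons]
    refine Fin.cases ?_ (fun e => ?_) e
    · have : (List.ofFn fun j : Fin k => if j.succ = 0 then P else (1 : Op n)).prod = 1 := by
        simp [Fin.succ_ne_zero]
      rw [this]; simp
    · simp only [Fin.succ_inj, (Fin.succ_ne_zero e).symm, if_false, one_mul]
      exact prod_ofFn_ite e P

/-- The sum over sign vectors factorizes over the pairs: each factor `j ≠ e` sums to `1`, and the
factor `e` sums to its bilinear by the spectral decomposition. -/
lemma sum_layerProj {n : ℕ} (ℓ : Fin (2 * n - 1)) (e : Fin n) :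
    ∑ x : Fin n → ℤˣ, ((x e : ℤ) : ℂ) • layerProj ℓ x = layerBilinear ℓ e := by
  have h : ∀ x : Fin n → ℤˣ, ((x e : ℤ) : ℂ) • layerProj ℓ x =
      (List.ofFn fun j => (if j = e then ((x j : ℤ) : ℂ) else 1) •
        signProj (layerBilinear ℓ j) (x j)).prod := by
    intro x
    rw [prod_ofFn_smul, layerProj]
    simp
  simp only [h]
  rw [sum_prod_ofFn fun j (s : ℤˣ) => (if j = e then ((s : ℤ) : ℂ) else 1) •
    signProj (layerBilinear ℓ j) s, ← prod_ofFn_ite e (layerBilinear ℓ e)]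
  congr 2
  funext j
  by_cases hj : j = e
  · subst hj
    simp only [if_true, sum_signProj_mul]
  · simp only [hj, if_false, one_smul, signProj_sum]

lemma layerMeasurement_mean {n : ℕ} (ρ : Op n) (ℓ : Fin (2 * n - 1)) (e : Fin n) :
    ∑ x, (layerMeasurement ℓ).prob ρ x * ((x e : ℤ) : ℝ) =
      covariance ρ (layerPair ℓ e).1 (layerPair ℓ e).2 := by
  rw [covariance_eq _ (layerPair_lt ℓ e).ne]
  change _ = (ρ * layerBilinear ℓ e).trace.re
  rw [← sum_layerProj, Finset.mul_sum, Matrix.trace_sum, Complex.re_sum]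
  refine Finset.sum_congr rfl fun x _ => ?_
  rw [Matrix.mul_smul, Matrix.trace_smul, smul_eq_mul, POVM.prob, mul_comm]
  change _ * (ρ * layerProj ℓ x).trace.re = _
  rw [← Complex.ofReal_intCast, Complex.re_ofReal_mul]

lemma faf_one {n : ℕ} (ρ : Op n) :
    faf 1 ρ = n - ∑ a, ∑ b ∈ Finset.Ioi a, covariance ρ a b ^ 2 := by
  have hT : ∀ a b, covariance ρ b a = -covariance ρ a b := fun a b => by
    have := congrFun (congrFun (covariance_transpose ρ) a) b
    simpa using this
  have hd : ∀ a, covariance ρ a a = 0 := fun a => by linarith [hT a a]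
  have h1 : (-(covariance ρ * covariance ρ)).trace = ∑ a, ∑ b, covariance ρ a b ^ 2 := by
    simp only [Matrix.trace, Matrix.diag_apply, Matrix.neg_apply, Matrix.mul_apply,
      ← Finset.sum_neg_distrib]
    refine Finset.sum_congr rfl fun a _ => Finset.sum_congr rfl fun b _ => ?_
    rw [hT a b]; ring
  have h2 : ∑ a, ∑ b, covariance ρ a b ^ 2 =
      2 * ∑ a, ∑ b ∈ Finset.Ioi a, covariance ρ a b ^ 2 := by
    have h3 : ∀ a, ∑ b, covariance ρ a b ^ 2 = ∑ b ∈ Finset.Ioi a, covariance ρ a b ^ 2 +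
        ∑ b ∈ Finset.Iio a, covariance ρ a b ^ 2 := by
      intro a
      rw [← Finset.sum_union]
      · symm
        refine Finset.sum_subset (Finset.subset_univ _) fun b _ hb => ?_
        have : a = b := by
          simp only [Finset.mem_union, Finset.mem_Ioi, Finset.mem_Iio, not_or, not_lt] at hb
          exact le_antisymm hb.2 hb.1
        rw [← this, hd]; simp
      · exact Finset.disjoint_left.mpr fun b hb hb' =>
          lt_asymm (Finset.mem_Ioi.mp hb) (Finset.mem_Iio.mp hb')
    have h4 : ∑ a, ∑ b ∈ Finset.Iio a, covariance ρ a b ^ 2 =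
        ∑ a, ∑ b ∈ Finset.Ioi a, covariance ρ a b ^ 2 := by
      rw [Finset.sum_comm' (t' := Finset.univ) (s' := fun b => Finset.Ioi b) (by simp)]
      refine Finset.sum_congr rfl fun a _ => Finset.sum_congr rfl fun b _ => ?_
      rw [hT a b]; ring
    simp only [h3, Finset.sum_add_distrib, h4]
    ring
  rw [faf, pow_one, h1, h2]
  ring

/-! ### Mean and variance of the estimate from one run -/

/-- The `±1` outcomes of a layer as reals. -/
def signVector {n : ℕ} (x : Fin n → ℤˣ) (e : Fin n) : ℝ := ((x e : ℤ) : ℝ)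

lemma fafEstimate_eq {n M : ℕ} (ω : Fin (2 * n - 1) × Fin M → Fin n → ℤˣ) :
    fafEstimate ω = n - uStatistic signVector ω := rfl

lemma sum_layers_covariance {n : ℕ} (ρ : Op n) :
    ∑ ℓ : Fin (2 * n - 1), ∑ e, covariance ρ (layerPair ℓ e).1 (layerPair ℓ e).2 ^ 2 =
      n - faf 1 ρ := by
  rw [sum_layerPair fun a b => covariance ρ a b ^ 2, faf_one]
  ring

lemma expectation_fafEstimate {n M : ℕ} (hM : 2 ≤ M) {ρ : Op n} (hρ : IsState ρ) :
    expectation (runMeasurement n M) ρ fafEstimate = faf 1 ρ := by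
  have h1 : ∀ p : Fin (2 * n - 1) × Fin M, ∑ x, (layerMeasurement p.1).prob ρ x = 1 :=
    fun p => POVM.sum_prob _ hρ
  have h := productExp_uStatistic (M := M) hM (fun ℓ => (layerMeasurement ℓ).sum_prob hρ)
    (X := signVector) (layerMeasurement_mean ρ)
  rw [sum_layers_covariance] at h
  rw [expectation_eq_productExp, show (fafEstimate : (Fin (2 * n - 1) × Fin M → _) → ℝ) =
    fun ω => n + (-1) * uStatistic signVector ω from funext fun ω => by rw [fafEstimate_eq]; ring]
  change productExp (fun p : Fin (2 * n - 1) × Fin M => (layerMeasurement p.1).prob ρ) _ = _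
  rw [productExp_add, productExp_const_mul, h,
    productExp_const (w := fun p : Fin (2 * n - 1) × Fin M => (layerMeasurement p.1).prob ρ) h1]
  ring

/-- The squared means over all layers sum to `n - FAF₁ ≤ n`, which is where `h0` is needed. The
constant `256` is `128 * 2`, from the degenerate part and at most `2n` layers. -/
lemma variance_fafEstimate_le {n M : ℕ} (hM : 2 ≤ M) {ρ : Op n} (hρ : IsState ρ)
    (h0 : 0 ≤ faf 1 ρ) :
    variance (runMeasurement n M) ρ fafEstimate ≤
      256 * ((n : ℝ) ^ 2 / M + (n : ℝ) ^ 3 / (M : ℝ) ^ 2) := by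
  have hM' : (2 : ℝ) ≤ M := by exact_mod_cast hM
  have h := variance_uStatistic_le (M := M) hM (fun ℓ => (layerMeasurement ℓ).prob_nonneg hρ)
    (fun ℓ => (layerMeasurement ℓ).sum_prob hρ)
    (X := signVector) (layerMeasurement_mean ρ) (fun x e => by
      rcases Int.units_eq_one_or (x e) with h | h <;> simp [signVector, h])
  rw [sum_layers_covariance] at h
  rw [variance, expectation_fafEstimate hM hρ, expectation_eq_productExp]
  rw [show (fun ω : Fin (2 * n - 1) × Fin M → Fin n → ℤˣ => (fafEstimate ω - faf 1 ρ) ^ 2) =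
    fun ω => (uStatistic signVector ω - (n - faf 1 ρ)) ^ 2 from
      funext fun ω => by rw [fafEstimate_eq]; ring]
  refine h.trans ?_
  have hL : ((2 * n - 1 : ℕ) : ℝ) ≤ 2 * n := by
    have : 2 * n - 1 ≤ 2 * n := by omega
    exact_mod_cast this
  rw [mul_add]
  refine add_le_add ?_ ?_
  · calc 8 * (n : ℝ) / M * (n - faf 1 ρ) ≤ 8 * n / M * n := by gcongr; linarith
      _ = 8 * ((n : ℝ) ^ 2 / M) := by ring
      _ ≤ _ := by gcongr; norm_num
  · calc _ ≤ 128 * (2 * (n : ℝ)) * (n : ℝ) ^ 2 / (M : ℝ) ^ 2 := by gcongr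
      _ = _ := by ring

/-! ### The normal form of real antisymmetric matrices -/

universe u

section NormalForm

variable {E : Type u} [NormedAddCommGroup E] [InnerProductSpace ℝ E]

local notation "⟪" x ", " y "⟫" => inner ℝ x y

/-- The operator `T²` is symmetric, so it has an orthonormal eigenbasis. For a basis vector `b` with
`T b ≠ 0` the eigenvalue is `-‖T b‖²`, and `b` together with the normalized `-T b` spans an
invariant plane. -/
lemma exists_skew_pair [FiniteDimensional ℝ E] (T : E →ₗ[ℝ] E)
    (hT : ∀ x y, ⟪T x, y⟫ = -⟪x, T y⟫) (h0 : T ≠ 0) :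
    ∃ (x y : E) (c : ℝ), ‖x‖ = 1 ∧ ‖y‖ = 1 ∧ ⟪x, y⟫ = 0 ∧ 0 ≤ c ∧ T x = -c • y ∧ T y = c • x := by
  have hS : (T ∘ₗ T).IsSymmetric := fun x y => by simp [hT]
  set b := hS.eigenvectorBasis rfl with hb
  obtain ⟨i, hi⟩ : ∃ i, T (b i) ≠ 0 := by
    by_contra! h
    exact h0 (b.toBasis.ext fun i => by simp [h i])
  have hSi : T (T (b i)) = hS.eigenvalues rfl i • b i := hS.apply_eigenvectorBasis rfl i
  have hbi : ‖b i‖ = 1 := b.orthonormal.1 i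
  set m := hS.eigenvalues rfl i
  have hc : 0 < ‖T (b i)‖ := norm_pos_iff.mpr hi
  have hm : m = -‖T (b i)‖ ^ 2 := by
    have h1 : ⟪T (T (b i)), b i⟫ = m := by
      rw [hSi, inner_smul_left, real_inner_self_eq_norm_sq, hbi]; simp
    rw [← h1, hT, real_inner_self_eq_norm_sq]
  refine ⟨b i, -‖T (b i)‖⁻¹ • T (b i), ‖T (b i)‖, hbi, ?_, ?_, hc.le, ?_, ?_⟩
  · rw [norm_smul, norm_neg, norm_inv, norm_norm, inv_mul_cancel₀ hc.ne']
  · have : ⟪b i, T (b i)⟫ = 0 := by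
      have := hT (b i) (b i)
      rw [real_inner_comm] at this
      linarith
    rw [inner_smul_right, this, mul_zero]
  · rw [smul_smul, neg_mul_neg, mul_inv_cancel₀ hc.ne', one_smul]
  · rw [map_smul, hSi, smul_smul, hm]
    congr 1
    field_simp

/-- Induction on the dimension: the orthogonal complement of an invariant plane is invariant by
antisymmetry. The space `E` is quantified inside the statement so that the induction hypothesis
applies to the complement. -/
lemma exists_skew_normal_form (n : ℕ) :
    ∀ {E : Type u} [NormedAddCommGroup E] [InnerProductSpace ℝ E] [FiniteDimensional ℝ E],
      Module.finrank ℝ E = 2 * n → ∀ T : E →ₗ[ℝ] E, (∀ x y, ⟪T x, y⟫ = -⟪x, T y⟫) →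
      ∃ (f : Fin n × Fin 2 → E) (c : Fin n → ℝ), Orthonormal ℝ f ∧ (∀ j, 0 ≤ c j) ∧
        ∀ j, T (f (j, 0)) = -c j • f (j, 1) ∧ T (f (j, 1)) = c j • f (j, 0) := by
  induction n with
  | zero =>
    intro E _ _ _ _ T _
    exact ⟨fun p => p.1.elim0, fun j => j.elim0, ⟨fun p => p.1.elim0, fun p => p.1.elim0⟩,
      fun j => j.elim0, fun j => j.elim0⟩
  | succ n ih =>
    intro E _ _ _ hE T hT
    by_cases h0 : T = 0
    · let b := (stdOrthonormalBasis ℝ E).reindex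
        ((finCongr (hE.trans (mul_comm _ _))).trans finProdFinEquiv.symm)
      exact ⟨b, fun _ => 0, b.orthonormal, fun _ => le_rfl, fun j => by simp [h0]⟩
    · obtain ⟨x, y, c, hx, hy, hxy, hc, hTx, hTy⟩ := exists_skew_pair T hT h0
      have hxx : ⟪x, x⟫ = 1 := by rw [real_inner_self_eq_norm_sq, hx, one_pow]
      have hyy : ⟪y, y⟫ = 1 := by rw [real_inner_self_eq_norm_sq, hy, one_pow]
      have hyx : ⟪y, x⟫ = 0 := by rw [real_inner_comm, hxy]
      let S : Submodule ℝ E := Submodule.span ℝ {x, y}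
      have hmem : ∀ z, z ∈ Sᗮ ↔ ⟪x, z⟫ = 0 ∧ ⟪y, z⟫ = 0 := by
        intro z
        rw [Submodule.mem_orthogonal]
        constructor
        · intro h
          exact ⟨h x (Submodule.subset_span (by simp)), h y (Submodule.subset_span (by simp))⟩
        · rintro ⟨h1, h2⟩ w hw
          obtain ⟨a, b, rfl⟩ := Submodule.mem_span_pair.mp hw
          rw [inner_add_left, inner_smul_left, inner_smul_left, h1, h2]
          simp
      have hinv : ∀ z ∈ Sᗮ, T z ∈ Sᗮ := by
        intro z hz
        rw [hmem] at hz ⊢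
        have h1 := hT x z
        have h2 := hT y z
        rw [hTx, inner_smul_left, hz.2] at h1
        rw [hTy, inner_smul_left, hz.1] at h2
        constructor <;> linarith
      have hlin : LinearIndependent ℝ ![x, y] := by
        rw [LinearIndependent.pair_iff]
        intro s t hst
        have h1 : ⟪x, s • x + t • y⟫ = 0 := by rw [hst, inner_zero_right]
        have h2 : ⟪y, s • x + t • y⟫ = 0 := by rw [hst, inner_zero_right]
        rw [inner_add_right, inner_smul_right, inner_smul_right, hxx, hxy] at h1
        rw [inner_add_right, inner_smul_right, inner_smul_right, hyy, hyx] at h2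
        constructor <;> linarith
      have hfS : Module.finrank ℝ S = 2 := by
        have := finrank_span_eq_card hlin
        rwa [show Set.range ![x, y] = {x, y} by
          simp [Matrix.range_cons, Matrix.range_empty, Set.pair_comm y x], Fintype.card_fin] at this
      have hK : Module.finrank ℝ Sᗮ = 2 * n := by
        have := S.finrank_add_finrank_orthogonal
        omega
      obtain ⟨f, d, hf, hd, hfd⟩ := ih hK (T.restrict hinv) fun z w => hT z w
      refine ⟨fun p => Fin.cases (![x, y] p.2) (fun j => (f (j, p.2) : E)) p.1,
        Fin.cons c d, ?_, ?_, ?_⟩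
      · have hf' := orthonormal_iff_ite.mp hf
        have hff : ∀ p q, ⟪(f p : E), (f q : E)⟫ = if p = q then 1 else 0 := fun p q => hf' p q
        have hxf : ∀ p, ⟪x, (f p : E)⟫ = 0 := fun p => ((hmem _).mp (f p).2).1
        have hyf : ∀ p, ⟪y, (f p : E)⟫ = 0 := fun p => ((hmem _).mp (f p).2).2
        have hfx : ∀ p, ⟪(f p : E), x⟫ = 0 := fun p => by rw [real_inner_comm, hxf]
        have hfy : ∀ p, ⟪(f p : E), y⟫ = 0 := fun p => by rw [real_inner_comm, hyf]
        rw [orthonormal_iff_ite]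
        rintro ⟨i, s⟩ ⟨j, t⟩
        refine Fin.cases ?_ (fun i => ?_) i <;> refine Fin.cases ?_ (fun j => ?_) j
        · fin_cases s <;> fin_cases t <;> simp [hxy, hyx, hx, hy]
        · fin_cases s <;> simp [hxf, hyf, (Fin.succ_ne_zero j).symm]
        · fin_cases t <;> simp [hfx, hfy, Fin.succ_ne_zero i]
        · simp [hff]
      · intro j
        refine Fin.cases ?_ (fun j => ?_) j
        · simpa using hc
        · simpa using hd j
      · intro j
        refine Fin.cases ?_ (fun j => ?_) j
        · exact ⟨hTx, hTy⟩
        · exact ⟨congrArg Subtype.val (hfd j).1, congrArg Subtype.val (hfd j).2⟩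

end NormalForm

/-- An antisymmetric real matrix is block diagonal in a suitable orthonormal basis, which is given
by the rows of `O`. -/
lemma exists_antisymm_normal_form {n : ℕ} {Γ : Matrix (Fin (2 * n)) (Fin (2 * n)) ℝ}
    (hΓ : Γᵀ = -Γ) :
    ∃ (O : Matrix (Fin n × Fin 2) (Fin (2 * n)) ℝ) (c : Fin n → ℝ), O * Oᵀ = 1 ∧ Oᵀ * O = 1 ∧
      (∀ j, 0 ≤ c j) ∧
      ∀ j, Γ *ᵥ O (j, 0) = -c j • O (j, 1) ∧ Γ *ᵥ O (j, 1) = c j • O (j, 0) := by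
  obtain ⟨f, c, hf, hc, hfc⟩ := exists_skew_normal_form n
    (E := EuclideanSpace ℝ (Fin (2 * n))) (by simp) (Matrix.toEuclideanLin Γ) (by
      intro x y
      simp only [EuclideanSpace.inner_eq_star_dotProduct, Matrix.ofLp_toLpLin, Matrix.toLin'_apply,
        star_trivial]
      rw [dotProduct_mulVec, ← mulVec_transpose, hΓ, Matrix.neg_mulVec, neg_dotProduct])
  let O : Matrix (Fin n × Fin 2) (Fin (2 * n)) ℝ := Matrix.of fun p => (f p).ofLp
  have hO : O * Oᵀ = 1 := by
    ext p q
    have := orthonormal_iff_ite.mp hf q p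
    rw [EuclideanSpace.inner_eq_star_dotProduct, star_trivial] at this
    rw [Matrix.mul_apply, Matrix.one_apply]
    simp only [eq_comm (a := p)]
    rw [← this]
    rfl
  refine ⟨O, c, hO, ?_, hc, fun j => ⟨?_, ?_⟩⟩
  · exact (Matrix.mul_eq_one_comm_of_equiv
      (finProdFinEquiv.trans (finCongr (mul_comm n 2)))).mp hO
  · have := congrArg WithLp.ofLp (hfc j).1
    rwa [Matrix.ofLp_toLpLin] at this
  · have := congrArg WithLp.ofLp (hfc j).2
    rwa [Matrix.ofLp_toLpLin] at this

/-- By antisymmetry `-Γ² = Γᵀ Γ`, whose trace is the sum of `‖Γ x‖²` over the orthonormal rows `x`;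
each of the two rows of block `j` gives `c_j²`. -/
lemma trace_neg_sq_eq_of_normal_form {n : ℕ} {Γ : Matrix (Fin (2 * n)) (Fin (2 * n)) ℝ}
    (hΓ : Γᵀ = -Γ) {O : Matrix (Fin n × Fin 2) (Fin (2 * n)) ℝ} {c : Fin n → ℝ}
    (hO : O * Oᵀ = 1) (hO' : Oᵀ * O = 1)
    (h : ∀ j, Γ *ᵥ O (j, 0) = -c j • O (j, 1) ∧ Γ *ᵥ O (j, 1) = c j • O (j, 0)) :
    (-(Γ * Γ)).trace = 2 * ∑ j, c j ^ 2 := by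
  have hrow : ∀ p, O p ⬝ᵥ O p = 1 := fun p => by
    have := congrFun (congrFun hO p) p
    rwa [Matrix.one_apply_eq] at this
  have h1 : (-(Γ * Γ)).trace = ∑ p, (Γ *ᵥ O p) ⬝ᵥ (Γ *ᵥ O p) := by
    calc (-(Γ * Γ)).trace = (Γᵀ * Γ * (Oᵀ * O)).trace := by rw [hO', mul_one, hΓ, neg_mul]
      _ = ((O * Γᵀ) * (Γ * Oᵀ)).trace := by
          rw [← Matrix.mul_assoc, Matrix.trace_mul_comm]
          simp only [Matrix.mul_assoc]
      _ = _ := by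
          rw [← Matrix.transpose_transpose O, ← Matrix.transpose_mul, Matrix.transpose_transpose]
          rfl
  rw [h1, Fintype.sum_prod_type, Finset.mul_sum]
  refine Finset.sum_congr rfl fun j _ => ?_
  rw [Fin.sum_univ_two, (h j).1, (h j).2]
  simp only [smul_dotProduct, dotProduct_smul, hrow, smul_eq_mul]
  ring

/-! ### Rotated Majorana operators -/

/-- The Majorana operator of the real mode `x`. -/
def rotMajorana {n : ℕ} (x : Fin (2 * n) → ℝ) : Op n := ∑ a, (x a : ℂ) • majorana a

/-- The bilinear of two real modes. -/
def rotBilinear {n : ℕ} (x y : Fin (2 * n) → ℝ) : Op n :=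
  -Complex.I • (rotMajorana x * rotMajorana y)

lemma rotMajorana_conjTranspose {n : ℕ} (x : Fin (2 * n) → ℝ) :
    (rotMajorana x)ᴴ = rotMajorana x := by
  simp [rotMajorana, Matrix.conjTranspose_sum, Matrix.conjTranspose_smul, majorana_conjTranspose]

lemma rotMajorana_mul {n : ℕ} (x y : Fin (2 * n) → ℝ) :
    rotMajorana x * rotMajorana y =
      ∑ a, ∑ b, ((x a : ℂ) * (y b : ℂ)) • (majorana a * majorana b) := by
  simp only [rotMajorana, Finset.sum_mul_sum, smul_mul_smul_comm]

lemma majorana_anticomm {n : ℕ} (a b : Fin (2 * n)) :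
    majorana a * majorana b + majorana b * majorana a = if a = b then 2 else 0 := by
  by_cases h : a = b
  · subst h
    rw [majorana_sq, if_pos rfl, one_add_one_eq_two]
  · rw [majorana_swap h, add_neg_cancel, if_neg h]

/-- The anticommutation relation is bilinear, so orthonormal real modes obey the same relations as
the `γ_a`. This permits working in the basis adapted to `Γ`. -/
lemma rotMajorana_anticomm {n : ℕ} (x y : Fin (2 * n) → ℝ) :
    rotMajorana x * rotMajorana y + rotMajorana y * rotMajorana x =
      (2 * ((x ⬝ᵥ y : ℝ) : ℂ)) • (1 : Op n) := by
  rw [rotMajorana_mul, rotMajorana_mul y x, Finset.sum_comm (γ := Fin (2 * n)) (s := Finset.univ)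
    (f := fun a b => ((y a : ℂ) * (x b : ℂ)) • (majorana a * majorana b)),
    ← Finset.sum_add_distrib]
  simp only [← Finset.sum_add_distrib, mul_comm (y _ : ℂ), ← smul_add, majorana_anticomm]
  simp only [smul_ite, smul_zero, Finset.sum_ite_eq, Finset.mem_univ, if_true, dotProduct]
  rw [← Finset.sum_smul, Complex.ofReal_sum, show (2 : Op n) = (2 : ℂ) • 1 by
    rw [two_smul, one_add_one_eq_two], smul_smul, mul_comm]
  simp only [Complex.ofReal_mul]

lemma rotMajorana_sq {n : ℕ} {x : Fin (2 * n) → ℝ} (hx : x ⬝ᵥ x = 1) :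
    rotMajorana x * rotMajorana x = 1 := by
  have h := rotMajorana_anticomm x x
  rw [hx, ← two_smul ℂ, Complex.ofReal_one, mul_one] at h
  exact smul_right_injective _ (two_ne_zero' ℂ) h

lemma rotMajorana_swap {n : ℕ} {x y : Fin (2 * n) → ℝ} (h : x ⬝ᵥ y = 0) :
    rotMajorana y * rotMajorana x = -(rotMajorana x * rotMajorana y) := by
  have h := rotMajorana_anticomm x y
  rw [‹x ⬝ᵥ y = 0›, Complex.ofReal_zero, mul_zero, zero_smul] at h
  exact (neg_eq_of_add_eq_zero_right h).symm

lemma rotBilinear_sq {n : ℕ} {x y : Fin (2 * n) → ℝ} (hx : x ⬝ᵥ x = 1) (hy : y ⬝ᵥ y = 1)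
    (hxy : x ⬝ᵥ y = 0) : rotBilinear x y * rotBilinear x y = 1 := by
  have h : rotMajorana x * rotMajorana y * (rotMajorana x * rotMajorana y) = -1 := by
    calc rotMajorana x * rotMajorana y * (rotMajorana x * rotMajorana y)
        = rotMajorana x * (rotMajorana y * rotMajorana x) * rotMajorana y := by
          simp only [mul_assoc]
      _ = -(rotMajorana x * rotMajorana x * (rotMajorana y * rotMajorana y)) := by
          rw [rotMajorana_swap hxy]; simp only [mul_neg, neg_mul, mul_assoc]
      _ = -1 := by rw [rotMajorana_sq hx, rotMajorana_sq hy, mul_one]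
  simp [rotBilinear, h, smul_smul]

lemma rotBilinear_conjTranspose {n : ℕ} {x y : Fin (2 * n) → ℝ} (hxy : x ⬝ᵥ y = 0) :
    (rotBilinear x y)ᴴ = rotBilinear x y := by
  simp [rotBilinear, Matrix.conjTranspose_smul, Matrix.conjTranspose_mul,
    rotMajorana_conjTranspose, rotMajorana_swap hxy]

lemma rotBilinear_commute_rotMajorana {n : ℕ} {x y z : Fin (2 * n) → ℝ} (hxz : x ⬝ᵥ z = 0)
    (hyz : y ⬝ᵥ z = 0) : Commute (rotBilinear x y) (rotMajorana z) := by
  refine Commute.smul_left ?_ _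
  change rotMajorana x * rotMajorana y * rotMajorana z =
    rotMajorana z * (rotMajorana x * rotMajorana y)
  have h1 : rotMajorana y * rotMajorana z = -(rotMajorana z * rotMajorana y) := by
    rw [rotMajorana_swap hyz, neg_neg]
  have h2 : rotMajorana x * rotMajorana z = -(rotMajorana z * rotMajorana x) := by
    rw [rotMajorana_swap hxz, neg_neg]
  rw [mul_assoc, h1, mul_neg, ← mul_assoc, h2, neg_mul, neg_neg, mul_assoc]

lemma rotBilinear_anticomm_left {n : ℕ} {x y : Fin (2 * n) → ℝ} (hxy : x ⬝ᵥ y = 0) :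
    rotBilinear x y * rotMajorana x = -(rotMajorana x * rotBilinear x y) := by
  simp only [rotBilinear, smul_mul_assoc, mul_smul_comm]
  rw [mul_assoc, rotMajorana_swap hxy, mul_neg, smul_neg]

lemma rotBilinear_anticomm_right {n : ℕ} {x y : Fin (2 * n) → ℝ} (hxy : x ⬝ᵥ y = 0) :
    rotBilinear x y * rotMajorana y = -(rotMajorana y * rotBilinear x y) := by
  simp only [rotBilinear, smul_mul_assoc, mul_smul_comm]
  rw [← mul_assoc (rotMajorana y), rotMajorana_swap hxy, neg_mul, smul_neg, neg_neg]

/-- The covariance matrix in a rotated basis. -/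
lemma dotProduct_covariance_mulVec {n : ℕ} (ρ : Op n) (x y : Fin (2 * n) → ℝ) :
    x ⬝ᵥ covariance ρ *ᵥ y = (-(Complex.I / 2) *
      (ρ * (rotMajorana x * rotMajorana y - rotMajorana y * rotMajorana x)).trace).re := by
  rw [rotMajorana_mul, rotMajorana_mul y x, Finset.sum_comm (γ := Fin (2 * n)) (s := Finset.univ)
    (f := fun a b => ((y a : ℂ) * (x b : ℂ)) • (majorana a * majorana b)),
    ← Finset.sum_sub_distrib]
  simp only [← Finset.sum_sub_distrib, mul_comm (y _ : ℂ), ← smul_sub, Finset.mul_sum,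
    Matrix.trace_sum, Complex.re_sum, dotProduct, mulVec]
  refine Finset.sum_congr rfl fun a _ => Finset.sum_congr rfl fun b _ => ?_
  rw [Matrix.mul_smul, Matrix.trace_smul, smul_eq_mul, ← Complex.ofReal_mul,
    mul_left_comm (-(Complex.I / 2)), Complex.re_ofReal_mul, covariance, Matrix.of_apply]
  ring

lemma dotProduct_covariance_mulVec_of_orthogonal {n : ℕ} (ρ : Op n) {x y : Fin (2 * n) → ℝ}
    (hxy : x ⬝ᵥ y = 0) : x ⬝ᵥ covariance ρ *ᵥ y = (ρ * rotBilinear x y).trace.re := by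
  rw [dotProduct_covariance_mulVec, rotMajorana_swap hxy, sub_neg_eq_add, ← two_smul ℂ,
    rotBilinear, Matrix.mul_smul, Matrix.mul_smul, Matrix.trace_smul, Matrix.trace_smul,
    smul_eq_mul, smul_eq_mul, ← mul_assoc]
  congr 2
  ring

/-! ### Orthonormal families of modes -/

section Modes

variable {n : ℕ} {O : Matrix (Fin n × Fin 2) (Fin (2 * n)) ℝ}

/-- The bilinear of the pair number `j` of rows of `O`. -/
def modeBilinear (O : Matrix (Fin n × Fin 2) (Fin (2 * n)) ℝ) (j : Fin n) : Op n :=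
  rotBilinear (O (j, 0)) (O (j, 1))

lemma dotProduct_rows (hO : O * Oᵀ = 1) (p q : Fin n × Fin 2) :
    O p ⬝ᵥ O q = if p = q then 1 else 0 := by
  have := congrFun (congrFun hO p) q
  rwa [Matrix.one_apply] at this

lemma modeBilinear_sq (hO : O * Oᵀ = 1) (j : Fin n) : modeBilinear O j * modeBilinear O j = 1 :=
  rotBilinear_sq (by simp [dotProduct_rows hO]) (by simp [dotProduct_rows hO])
    (by simp [dotProduct_rows hO])

lemma modeBilinear_conjTranspose (hO : O * Oᵀ = 1) (j : Fin n) :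
    (modeBilinear O j)ᴴ = modeBilinear O j :=
  rotBilinear_conjTranspose (by simp [dotProduct_rows hO])

lemma modeBilinear_commute_row (hO : O * Oᵀ = 1) {j : Fin n} {p : Fin n × Fin 2} (hp : p.1 ≠ j) :
    Commute (modeBilinear O j) (rotMajorana (O p)) :=
  rotBilinear_commute_rotMajorana
    (by rw [dotProduct_rows hO, if_neg fun h => hp (by rw [← h])])
    (by rw [dotProduct_rows hO, if_neg fun h => hp (by rw [← h])])

lemma modeBilinear_anticomm_row (hO : O * Oᵀ = 1) {j : Fin n} {p : Fin n × Fin 2} (hp : p.1 = j) :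
    modeBilinear O j * rotMajorana (O p) = -(rotMajorana (O p) * modeBilinear O j) := by
  obtain ⟨i, s⟩ := p
  obtain rfl : i = j := hp
  have h : O (i, 0) ⬝ᵥ O (i, 1) = 0 := by simp [dotProduct_rows hO]
  fin_cases s
  · exact rotBilinear_anticomm_left h
  · exact rotBilinear_anticomm_right h

lemma modeBilinear_commute (hO : O * Oᵀ = 1) (i j : Fin n) :
    Commute (modeBilinear O i) (modeBilinear O j) := by
  by_cases h : i = j
  · rw [h]
  · exact ((modeBilinear_commute_row hO (p := (j, 0)) (Ne.symm h)).mul_right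
      (modeBilinear_commute_row hO (p := (j, 1)) (Ne.symm h))).smul_right _

/-- The joint `+1` projector of the mode bilinears. -/
def vacuumProj (O : Matrix (Fin n × Fin 2) (Fin (2 * n)) ℝ) : Op n :=
  (List.ofFn fun j => signProj (modeBilinear O j) 1).prod

lemma modeProj_spec (hO : O * Oᵀ = 1) :
    (∀ P ∈ List.ofFn fun j => signProj (modeBilinear O j) 1, P * P = P ∧ Pᴴ = P) ∧
    ∀ P ∈ List.ofFn fun j => signProj (modeBilinear O j) 1,
      ∀ Q ∈ List.ofFn fun j => signProj (modeBilinear O j) 1, Commute P Q := by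
  constructor
  · intro P hP
    obtain ⟨j, rfl⟩ := (List.mem_ofFn' _ _).mp hP
    exact ⟨signProj_mul_self (modeBilinear_sq hO j) _,
      signProj_conjTranspose (modeBilinear_conjTranspose hO j) _⟩
  · intro P hP Q hQ
    obtain ⟨i, rfl⟩ := (List.mem_ofFn' _ _).mp hP
    obtain ⟨j, rfl⟩ := (List.mem_ofFn' _ _).mp hQ
    exact signProj_commute (modeBilinear_commute hO i j) _ _

lemma vacuumProj_spec (hO : O * Oᵀ = 1) :
    vacuumProj O * vacuumProj O = vacuumProj O ∧ (vacuumProj O)ᴴ = vacuumProj O :=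
  proj_prod _ (modeProj_spec hO).1 (modeProj_spec hO).2

lemma mul_prod_of_mem {R : Type*} [Monoid R] {B P : R} :
    ∀ {L : List R}, P ∈ L → B * P = P → (∀ Q ∈ L, Commute B Q) → B * L.prod = L.prod
  | Q :: L, hP, hB, hc => by
    rw [List.prod_cons]
    rcases List.mem_cons.mp hP with rfl | hP
    · rw [← mul_assoc, hB]
    · rw [← mul_assoc, (hc Q (by simp)).eq, mul_assoc,
        mul_prod_of_mem hP hB fun R hR => hc R (by simp [hR])]

lemma modeBilinear_mul_vacuumProj (hO : O * Oᵀ = 1) (j : Fin n) :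
    modeBilinear O j * vacuumProj O = vacuumProj O := by
  refine mul_prod_of_mem (P := signProj (modeBilinear O j) 1)
    ((List.mem_ofFn' _ _).mpr ⟨j, rfl⟩) ?_ ?_
  · simp only [signProj, Units.val_one, Int.cast_one, one_smul, mul_smul_comm, mul_add, mul_one,
      modeBilinear_sq hO]
    rw [add_comm]
  · intro Q hQ
    obtain ⟨i, rfl⟩ := (List.mem_ofFn' _ _).mp hQ
    exact ((Commute.one_right _).add_right ((modeBilinear_commute hO j i).smul_right _)).smul_right _

lemma posSemidef_of_proj {P : Op n} (h : P * P = P ∧ Pᴴ = P) : P.PosSemidef := by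
  have : P = Pᴴ * P := by rw [h.2, h.1]
  rw [this]
  exact Matrix.posSemidef_conjTranspose_mul_self _

/-- The union bound for commuting projectors. -/
lemma one_sub_trace_prod_le {ρ : Op n} (hρ : IsState ρ) :
    ∀ L : List (Op n), (∀ P ∈ L, P * P = P ∧ Pᴴ = P) → (∀ P ∈ L, ∀ Q ∈ L, Commute P Q) →
      1 - (ρ * L.prod).trace.re ≤ (L.map fun P => 1 - (ρ * P).trace.re).sum
  | [], _, _ => by simp [hρ.2]
  | P :: L, h, hc => by
    have ih := one_sub_trace_prod_le hρ L (fun Q hQ => h Q (by simp [hQ]))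
      (fun Q hQ R hR => hc Q (by simp [hQ]) R (by simp [hR]))
    obtain ⟨h1, h2⟩ := proj_prod L (fun Q hQ => h Q (by simp [hQ]))
      (fun Q hQ R hR => hc Q (by simp [hQ]) R (by simp [hR]))
    obtain ⟨h3, h4⟩ := h P (by simp)
    have hcomm : Commute P L.prod :=
      Commute.list_prod_right _ _ fun Q hQ => hc P (by simp) Q (by simp [hQ])
    -- The product of the commuting complements is a projector, so `1 - ⟨P⟩ - ⟨Q⟩ + ⟨P Q⟩ ≥ 0` with
    -- `Q = L.prod`.
    have hproj : (1 - P) * (1 - L.prod) * ((1 - P) * (1 - L.prod)) = (1 - P) * (1 - L.prod) ∧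
        ((1 - P) * (1 - L.prod))ᴴ = (1 - P) * (1 - L.prod) := by
      have hc' : Commute (1 - P) (1 - L.prod) :=
        ((Commute.one_left _).sub_left ((Commute.one_right _).sub_right hcomm))
      have hP : (1 - P) * (1 - P) = 1 - P := by simp [mul_sub, sub_mul, h3]
      have hL : (1 - L.prod) * (1 - L.prod) = 1 - L.prod := by simp [mul_sub, sub_mul, h1]
      constructor
      · rw [mul_assoc, ← mul_assoc (1 - L.prod), ← hc'.eq, mul_assoc, hL, ← mul_assoc, hP]
      · rw [Matrix.conjTranspose_mul, Matrix.conjTranspose_sub, Matrix.conjTranspose_sub, h2, h4,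
          Matrix.conjTranspose_one, hc'.eq]
    have hnn := trace_mul_re_nonneg hρ.1 (posSemidef_of_proj hproj)
    rw [show (1 - P) * (1 - L.prod) = 1 - P - L.prod + P * L.prod by noncomm_ring, mul_add,
      mul_sub, mul_sub, mul_one, Matrix.trace_add, Matrix.trace_sub, Matrix.trace_sub, hρ.2] at hnn
    simp only [Complex.add_re, Complex.sub_re, Complex.one_re] at hnn
    rw [List.map_cons, List.sum_cons, List.prod_cons]
    linarith

lemma trace_signProj {ρ : Op n} (hρ : IsState ρ) (B : Op n) :
    (ρ * signProj B 1).trace.re = (1 + (ρ * B).trace.re) / 2 := by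
  simp only [signProj, Units.val_one, Int.cast_one, one_smul, Matrix.mul_smul, Matrix.trace_smul,
    mul_add, mul_one, Matrix.trace_add, hρ.2, smul_eq_mul]
  rw [← mul_one_add, show (1 / 2 : ℂ) = ((1 / 2 : ℝ) : ℂ) by norm_num, Complex.re_ofReal_mul,
    Complex.add_re, Complex.one_re]
  ring

lemma one_sub_trace_vacuumProj_le (hO : O * Oᵀ = 1) {ρ : Op n} (hρ : IsState ρ) :
    1 - (ρ * vacuumProj O).trace.re ≤ ∑ j, (1 - (ρ * modeBilinear O j).trace.re) / 2 := by
  have h := one_sub_trace_prod_le hρ _ (modeProj_spec hO).1 (modeProj_spec hO).2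
  rw [List.map_ofFn, List.sum_ofFn] at h
  refine h.trans (le_of_eq (Finset.sum_congr rfl fun j _ => ?_))
  simp only [Function.comp]
  rw [trace_signProj hρ]
  ring

lemma trace_modeBilinear_le_one (hO : O * Oᵀ = 1) {ρ : Op n} (hρ : IsState ρ) (j : Fin n) :
    (ρ * modeBilinear O j).trace.re ≤ 1 := by
  have hP : ∀ s, signProj (modeBilinear O j) s * signProj (modeBilinear O j) s =
      signProj (modeBilinear O j) s ∧ (signProj (modeBilinear O j) s)ᴴ =
      signProj (modeBilinear O j) s := fun s =>
    ⟨signProj_mul_self (modeBilinear_sq hO j) s,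
      signProj_conjTranspose (modeBilinear_conjTranspose hO j) s⟩
  have h := trace_mul_re_nonneg hρ.1 (posSemidef_of_proj (hP (-1)))
  have hs := signProj_sum (modeBilinear O j)
  rw [show (Finset.univ : Finset ℤˣ) = {1, -1} from rfl, Finset.sum_pair (by decide)] at hs
  have h2 : (ρ * signProj (modeBilinear O j) 1).trace.re +
      (ρ * signProj (modeBilinear O j) (-1)).trace.re = 1 := by
    rw [← Complex.add_re, ← Matrix.trace_add, ← mul_add, hs, mul_one, hρ.2, Complex.one_re]
  rw [trace_signProj hρ] at h2
  linarith

/-- A state in the joint `+1` eigenspace of the mode bilinears has `Γ² = -1`. -/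
lemma covariance_sq_of_mode_eigen (hO : O * Oᵀ = 1) (hO' : Oᵀ * O = 1) {ρ : Op n}
    (hρ : ρ.trace = 1) (hl : ∀ j, modeBilinear O j * ρ = ρ) (hr : ∀ j, ρ * modeBilinear O j = ρ) :
    covariance ρ * covariance ρ = -1 := by
  let J : Matrix (Fin n × Fin 2) (Fin n × Fin 2) ℝ := Matrix.of fun p q =>
    if p.1 = q.1 then (if p.2 = q.2 then 0 else if p.2 = 0 then 1 else -1) else 0
  have hJ : O * covariance ρ * Oᵀ = J := by
    have hent : ∀ p q, (O * covariance ρ * Oᵀ) p q = O p ⬝ᵥ covariance ρ *ᵥ O q := by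
      intro p q
      rw [dotProduct_mulVec]
      rfl
    have hoff : ∀ p q : Fin n × Fin 2, p.1 ≠ q.1 → O p ⬝ᵥ covariance ρ *ᵥ O q = 0 := by
      intro p q hpq
      rw [dotProduct_covariance_mulVec_of_orthogonal _ (by
        rw [dotProduct_rows hO, if_neg fun h => hpq (by rw [h])]), rotBilinear]
      -- The bilinear of the block of `p` is inserted next to `ρ` and moved around the trace. It
      -- commutes with the mode `q` and anticommutes with the mode `p`, so the trace equals its own
      -- negative.
      have : (ρ * (rotMajorana (O p) * rotMajorana (O q))).trace =
          -(ρ * (rotMajorana (O p) * rotMajorana (O q))).trace := by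
        conv_lhs =>
          rw [← hl p.1, mul_assoc, Matrix.trace_mul_comm, mul_assoc]
        rw [mul_assoc, ← (modeBilinear_commute_row hO hpq.symm).eq, ← mul_assoc (rotMajorana (O p)),
          show rotMajorana (O p) * modeBilinear O p.1 = -(modeBilinear O p.1 * rotMajorana (O p)) by
            rw [modeBilinear_anticomm_row hO rfl, neg_neg], neg_mul, mul_neg, Matrix.trace_neg,
          mul_assoc, ← mul_assoc ρ, hr]
      have h0 : (ρ * (rotMajorana (O p) * rotMajorana (O q))).trace = 0 := by
        have := add_eq_zero_iff_eq_neg.mpr this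
        rw [← two_mul] at this
        simpa using this
      rw [Matrix.mul_smul, Matrix.trace_smul, h0]
      simp
    have hskew : ∀ x y : Fin (2 * n) → ℝ,
        x ⬝ᵥ covariance ρ *ᵥ y = -(y ⬝ᵥ covariance ρ *ᵥ x) := by
      intro x y
      rw [dotProduct_comm y, dotProduct_mulVec, ← mulVec_transpose, covariance_transpose,
        Matrix.neg_mulVec, neg_dotProduct]
    have hon : ∀ j, O (j, 0) ⬝ᵥ covariance ρ *ᵥ O (j, 1) = 1 := by
      intro j
      rw [dotProduct_covariance_mulVec_of_orthogonal _ (by simp [dotProduct_rows hO])]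
      change (ρ * modeBilinear O j).trace.re = 1
      rw [hr, hρ, Complex.one_re]
    have hdiag : ∀ x, x ⬝ᵥ covariance ρ *ᵥ x = 0 := fun x => by linarith [hskew x x]
    ext ⟨i, s⟩ ⟨j, t⟩
    rw [hent]
    by_cases h : i = j
    · subst h
      fin_cases s <;> fin_cases t
      · simpa [J] using hdiag _
      · simpa [J] using hon i
      · have := hskew (O (i, 1)) (O (i, 0))
        rw [hon] at this
        simpa [J] using this
      · simpa [J] using hdiag _
    · rw [hoff _ _ h]
      simp [J, h]
  have hJJ : J * J = -1 := by
    ext ⟨i, s⟩ ⟨j, t⟩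
    rw [Matrix.mul_apply, Fintype.sum_prod_type]
    by_cases h : i = j
    · subst h
      rw [Finset.sum_eq_single i]
      · fin_cases s <;> fin_cases t <;> simp [J]
      · intro k _ hk
        simp [J, hk.symm]
      · simp
    · have : ∀ k, ∑ r, J (i, s) (k, r) * J (k, r) (j, t) = 0 := by
        intro k
        refine Finset.sum_eq_zero fun r _ => ?_
        by_cases hk : i = k
        · subst hk; simp [J, h]
        · simp [J, hk]
      simp [this, h]
  have hΓ : covariance ρ = Oᵀ * J * O := by
    rw [← hJ]
    calc covariance ρ = Oᵀ * O * covariance ρ * (Oᵀ * O) := by rw [hO', one_mul, mul_one]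
      _ = _ := by simp only [Matrix.mul_assoc]
  calc covariance ρ * covariance ρ = Oᵀ * J * (O * Oᵀ) * J * O := by
        rw [hΓ]; simp only [Matrix.mul_assoc]
    _ = Oᵀ * (J * J) * O := by rw [hO, Matrix.mul_one]; simp only [Matrix.mul_assoc]
    _ = -1 := by rw [hJJ, Matrix.mul_neg, Matrix.mul_one, Matrix.neg_mul, hO']

end Modes

/-! ### Antiflatness of a state in the normal form of its covariance matrix -/

/-- The modes are ordered within each block so that the expectations `c_j` are nonnegative; hence
the joint `+1` eigenspace is the right one to project on. -/
lemma exists_mode_decomposition {n : ℕ} (ρ : Op n) :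
    ∃ O : Matrix (Fin n × Fin 2) (Fin (2 * n)) ℝ, O * Oᵀ = 1 ∧ Oᵀ * O = 1 ∧
      (∀ j, 0 ≤ (ρ * modeBilinear O j).trace.re) ∧
      faf 1 ρ = ∑ j, (1 - (ρ * modeBilinear O j).trace.re ^ 2) := by
  obtain ⟨O, c, hO, hO', hc, h⟩ := exists_antisymm_normal_form (covariance_transpose ρ)
  have hcj : ∀ j, (ρ * modeBilinear O j).trace.re = c j := by
    intro j
    rw [modeBilinear, ← dotProduct_covariance_mulVec_of_orthogonal _ (by simp [dotProduct_rows hO]),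
      (h j).2, dotProduct_smul, dotProduct_rows hO, if_pos rfl, smul_eq_mul, mul_one]
  refine ⟨O, hO, hO', fun j => by rw [hcj]; exact hc j, ?_⟩
  simp only [hcj]
  rw [faf, pow_one, trace_neg_sq_eq_of_normal_form (covariance_transpose ρ) hO hO' h]
  simp [Finset.sum_sub_distrib]

lemma faf_one_nonneg {n : ℕ} {ρ : Op n} (hρ : IsState ρ) : 0 ≤ faf 1 ρ := by
  obtain ⟨O, hO, _, h0, h⟩ := exists_mode_decomposition _
  rw [h]
  refine Finset.sum_nonneg fun j _ => ?_
  nlinarith [h0 j, trace_modeBilinear_le_one hO hρ j]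

/-! ### Pure states and the trace distance -/

lemma isState_ketbra {n : ℕ} {ψ : Bits n → ℂ} (hψ : IsUnitVector ψ) : IsState (ketbra ψ) := by
  refine ⟨posSemidef_vecMulVec_self_star ψ, ?_⟩
  rw [ketbra, Matrix.trace_vecMulVec, dotProduct_comm]
  exact hψ

lemma trace_ketbra_mul {n : ℕ} (ψ : Bits n → ℂ) (A : Op n) :
    (ketbra ψ * A).trace = star ψ ⬝ᵥ A *ᵥ ψ := by
  rw [ketbra, Matrix.trace_mul_comm, Matrix.mul_vecMulVec, Matrix.trace_vecMulVec, dotProduct_comm]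

lemma traceNorm_nonneg {n : ℕ} (A : Op n) : 0 ≤ traceNorm A :=
  Finset.sum_nonneg fun _ _ => Real.sqrt_nonneg _

/-- Cauchy–Schwarz over the nonzero singular values, whose number is the rank. -/
lemma traceNorm_sq_le {n : ℕ} (A : Op n) :
    traceNorm A ^ 2 ≤ A.rank * (Aᴴ * A).trace.re := by
  set h := isHermitian_conjTranspose_mul_self A
  have hnn : ∀ i, 0 ≤ h.eigenvalues i := fun i => eigenvalues_conjTranspose_mul_self_nonneg A i
  have htr : (Aᴴ * A).trace.re = ∑ i, h.eigenvalues i := by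
    rw [h.trace_eq_sum_eigenvalues, Complex.re_sum]
    rfl
  have hrank : A.rank = (Finset.univ.filter fun i => h.eigenvalues i ≠ 0).card := by
    rw [← Matrix.rank_conjTranspose_mul_self, h.rank_eq_card_non_zero_eigs, Fintype.card_subtype]
  have hsum : traceNorm A =
      ∑ i ∈ Finset.univ.filter fun i => h.eigenvalues i ≠ 0, √(h.eigenvalues i) := by
    rw [traceNorm]
    symm
    refine Finset.sum_subset (Finset.subset_univ _) fun i _ hi => ?_
    have : h.eigenvalues i = 0 := by simpa using hi
    rw [this, Real.sqrt_zero]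
  rw [hsum, hrank, htr]
  refine (sq_sum_le_card_mul_sum_sq).trans ?_
  refine mul_le_mul_of_nonneg_left ?_ (Nat.cast_nonneg _)
  simp only [Real.sq_sqrt (hnn _)]
  exact Finset.sum_le_sum_of_subset_of_nonneg (Finset.subset_univ _) fun i _ _ => hnn i

lemma trace_ketbra_mul_ketbra {n : ℕ} (ψ φ : Bits n → ℂ) :
    (ketbra ψ * ketbra φ).trace = ((‖star φ ⬝ᵥ ψ‖ ^ 2 : ℝ) : ℂ) := by
  rw [trace_ketbra_mul, ketbra, Matrix.vecMulVec_mulVec, dotProduct_smul]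
  have h : star ψ ⬝ᵥ φ = star (star φ ⬝ᵥ ψ) := by
    rw [← Matrix.star_dotProduct_star, star_star, dotProduct_comm]
  rw [h, Complex.ofReal_pow, ← Complex.mul_conj']
  simp [mul_comm]

lemma ketbra_conjTranspose {n : ℕ} (ψ : Bits n → ℂ) : (ketbra ψ)ᴴ = ketbra ψ :=
  (posSemidef_vecMulVec_self_star ψ).1

lemma rank_add_le {m : Type*} [Fintype m] (A B : Matrix m m ℂ) :
    (A + B).rank ≤ A.rank + B.rank := by
  unfold Matrix.rank
  refine (Submodule.finrank_mono (t := LinearMap.range A.mulVecLin ⊔ LinearMap.range B.mulVecLin)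
    ?_).trans (Submodule.finrank_add_le_finrank_add_finrank _ _)
  rintro _ ⟨x, rfl⟩
  rw [Matrix.mulVecLin_add, LinearMap.add_apply]
  exact Submodule.add_mem_sup ⟨x, rfl⟩ ⟨x, rfl⟩

/-- The difference has rank at most `2` and squared Hilbert–Schmidt norm `2 - 2 F`, where `F` is the
overlap, so the bound is `(1/4) * 2 * (2 - 2 F)`. No eigenvalue needs to be computed. -/
lemma traceDist_ketbra_sq_le {n : ℕ} {ψ φ : Bits n → ℂ} (hψ : IsUnitVector ψ)
    (hφ : IsUnitVector φ) : traceDist (ketbra ψ) (ketbra φ) ^ 2 ≤ 1 - ‖star φ ⬝ᵥ ψ‖ ^ 2 := by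
  have hrank : (ketbra ψ - ketbra φ).rank ≤ 2 := by
    have h1 : ∀ ψ : Bits n → ℂ, (ketbra ψ).rank ≤ 1 := fun ψ => Matrix.rank_vecMulVec_le _ _
    have h2 : (-ketbra φ).rank ≤ 1 := by
      rw [ketbra, ← Matrix.neg_vecMulVec]
      exact Matrix.rank_vecMulVec_le _ _
    rw [sub_eq_add_neg]
    exact (rank_add_le _ _).trans (add_le_add (h1 ψ) h2)
  have htr : ((ketbra ψ - ketbra φ)ᴴ * (ketbra ψ - ketbra φ)).trace.re =
      2 - 2 * ‖star φ ⬝ᵥ ψ‖ ^ 2 := by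
    have hn : ∀ χ : Bits n → ℂ, IsUnitVector χ → (ketbra χ * ketbra χ).trace = 1 := by
      intro χ hχ
      rw [trace_ketbra_mul_ketbra, hχ]
      simp
    rw [Matrix.conjTranspose_sub, ketbra_conjTranspose, ketbra_conjTranspose, sub_mul, mul_sub,
      mul_sub, Matrix.trace_sub, Matrix.trace_sub, Matrix.trace_sub, hn ψ hψ, hn φ hφ,
      Matrix.trace_mul_comm (ketbra φ), trace_ketbra_mul_ketbra]
    simp only [Complex.sub_re, Complex.one_re, Complex.ofReal_re]
    ring
  have h := traceNorm_sq_le (ketbra ψ - ketbra φ)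
  rw [htr] at h
  have hr : ((ketbra ψ - ketbra φ).rank : ℝ) ≤ 2 := by exact_mod_cast hrank
  have hnn : 0 ≤ 2 - 2 * ‖star φ ⬝ᵥ ψ‖ ^ 2 := by
    rw [← htr]
    exact (Complex.le_def.mp (Matrix.posSemidef_conjTranspose_mul_self _).trace_nonneg).1
  rw [traceDist, mul_pow]
  nlinarith [mul_le_mul_of_nonneg_right hr hnn]

lemma gaussianDist_le {n : ℕ} (ψ : Bits n → ℂ) {φ : Bits n → ℂ} (hφ : IsPureGaussian φ) :
    gaussianDist ψ ≤ traceDist (ketbra ψ) (ketbra φ) := by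
  refine ciInf_le (f := fun φ : {φ : Bits n → ℂ // IsPureGaussian φ} =>
    traceDist (ketbra ψ) (ketbra φ.1)) ⟨0, ?_⟩ ⟨φ, hφ⟩
  rintro _ ⟨χ, rfl⟩
  exact mul_nonneg (by norm_num) (traceNorm_nonneg _)

/-- If the joint `+1` projector of the modes has positive weight `F` on `ψ`, then some pure Gaussian
state has overlap `F` with `ψ`. -/
lemma exists_gaussian_overlap {n : ℕ} {O : Matrix (Fin n × Fin 2) (Fin (2 * n)) ℝ}
    (hO : O * Oᵀ = 1) (hO' : Oᵀ * O = 1) (ψ : Bits n → ℂ)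
    (hF : 0 < (ketbra ψ * vacuumProj O).trace.re) :
    ∃ φ, IsPureGaussian φ ∧ ‖star φ ⬝ᵥ ψ‖ ^ 2 = (ketbra ψ * vacuumProj O).trace.re := by
  obtain ⟨hP, hPH⟩ := vacuumProj_spec hO
  set P := vacuumProj O
  set F := (ketbra ψ * P).trace.re
  have hstar : star (P *ᵥ ψ) = star ψ ᵥ* P := by rw [star_mulVec, hPH]
  have hz : star (P *ᵥ ψ) ⬝ᵥ (P *ᵥ ψ) = star ψ ⬝ᵥ P *ᵥ ψ := by
    rw [hstar, ← dotProduct_mulVec, mulVec_mulVec, hP]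
  have hzF : star ψ ⬝ᵥ P *ᵥ ψ = (F : ℂ) := by
    have h0 : 0 ≤ star ψ ⬝ᵥ P *ᵥ ψ := by rw [← hz]; exact dotProduct_star_self_nonneg _
    have := (Complex.le_def.mp h0).2
    apply Complex.ext
    · rw [Complex.ofReal_re, ← trace_ketbra_mul]
    · rw [Complex.ofReal_im, ← this, Complex.zero_im]
  have hr : 0 < √F := Real.sqrt_pos.mpr hF
  have hrr : ((√F : ℝ) : ℂ) ^ 2 = F := by rw [← Complex.ofReal_pow, Real.sq_sqrt hF.le]
  have hr0 : ((√F : ℝ) : ℂ) ≠ 0 := by exact_mod_cast hr.ne'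
  -- As `P` is a projector, `‖P ψ‖² = ⟨ψ, P ψ⟩ = F`, so `√F` is the normalization.
  let φ : Bits n → ℂ := (((√F)⁻¹ : ℝ) : ℂ) • (P *ᵥ ψ)
  have hstarφ : star φ = (((√F)⁻¹ : ℝ) : ℂ) • star (P *ᵥ ψ) := by
    rw [star_smul]
    simp
  have hunit : IsUnitVector φ := by
    rw [IsUnitVector, hstarφ, smul_dotProduct, dotProduct_smul, hz, hzF, smul_eq_mul, smul_eq_mul,
      ← hrr, Complex.ofReal_inv]
    field_simp
  have hBφ : ∀ j, modeBilinear O j *ᵥ φ = φ := by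
    intro j
    rw [mulVec_smul, mulVec_mulVec, modeBilinear_mul_vacuumProj hO]
  have hl : ∀ j, modeBilinear O j * ketbra φ = ketbra φ := by
    intro j
    rw [ketbra, Matrix.mul_vecMulVec, hBφ]
  have hrm : ∀ j, ketbra φ * modeBilinear O j = ketbra φ := by
    intro j
    have := congrArg Matrix.conjTranspose (hl j)
    rwa [Matrix.conjTranspose_mul, ketbra_conjTranspose, modeBilinear_conjTranspose hO] at this
  refine ⟨φ, ⟨hunit, covariance_sq_of_mode_eigen hO hO' (isState_ketbra hunit).2 hl hrm⟩, ?_⟩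
  rw [hstarφ, smul_dotProduct, hstar, ← dotProduct_mulVec, hzF, smul_eq_mul, ← Complex.ofReal_mul,
    Complex.norm_real, Real.norm_eq_abs, sq_abs, mul_pow, inv_pow, Real.sq_sqrt hF.le]
  field_simp

/-- The antiflatness bounds the distance to the pure Gaussian states. -/
lemma two_mul_sq_le_faf {n : ℕ} {ψ : Bits n → ℂ} (hψ : IsUnitVector ψ) {ε : ℝ} (h0 : 0 ≤ ε)
    (h1 : ε ≤ 1) (hε : ε ≤ gaussianDist ψ) : 2 * ε ^ 2 ≤ faf 1 (ketbra ψ) := by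
  have hρ := isState_ketbra hψ
  obtain ⟨O, hO, hO', hc, hfaf⟩ := exists_mode_decomposition _
  have hF := one_sub_trace_vacuumProj_le hO hρ
  have hle : ∑ j, (1 - (ketbra ψ * modeBilinear O j).trace.re) / 2 ≤ faf 1 (ketbra ψ) / 2 := by
    rw [hfaf, Finset.sum_div]
    refine Finset.sum_le_sum fun j _ => ?_
    -- For `0 ≤ c ≤ 1` one has `c² ≤ c`, hence `1 - c ≤ 1 - c²`.
    nlinarith [hc j, trace_modeBilinear_le_one hO hρ j]
  by_cases hpos : 0 < (ketbra ψ * vacuumProj O).trace.re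
  · obtain ⟨φ, hφ, hov⟩ := exists_gaussian_overlap hO hO' ψ hpos
    have hd := traceDist_ketbra_sq_le hψ hφ.1
    have := pow_le_pow_left₀ h0 (hε.trans (gaussianDist_le ψ hφ)) 2
    rw [hov] at hd
    linarith
  -- With no weight on the projector there is nothing to normalize, but then `FAF₁ ≥ 2` and `ε ≤ 1`
  -- suffices.
  · have : ε ^ 2 ≤ 1 := pow_le_one₀ h0 h1
    linarith

lemma faf_one_of_gaussian {n : ℕ} {ψ : Bits n → ℂ} (hψ : IsPureGaussian ψ) :
    faf 1 (ketbra ψ) = 0 := by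
  rw [faf, pow_one, hψ.2, neg_neg, Matrix.trace_one, Fintype.card_fin]
  push_cast
  ring

/-! ### The median and the matching protocol -/

lemma exists_card_le_median {k : ℕ} (v : Fin (2 * k + 1) → ℝ) :
    ∃ A : Finset (Fin (2 * k + 1)), k + 1 ≤ A.card ∧ ∀ i ∈ A, v i ≤ median v := by
  refine ⟨(Finset.Iic ⟨k, by omega⟩).map (Tuple.sort v).toEmbedding, ?_, ?_⟩
  · rw [Finset.card_map, Fin.card_Iic]
  · intro i hi
    obtain ⟨j, hj, rfl⟩ := Finset.mem_map.mp hi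
    exact Tuple.monotone_sort v (Finset.mem_Iic.mp hj)

lemma exists_card_median_le {k : ℕ} (v : Fin (2 * k + 1) → ℝ) :
    ∃ A : Finset (Fin (2 * k + 1)), k + 1 ≤ A.card ∧ ∀ i ∈ A, median v ≤ v i := by
  refine ⟨(Finset.Ici ⟨k, by omega⟩).map (Tuple.sort v).toEmbedding, ?_, ?_⟩
  · rw [Finset.card_map, Fin.card_Ici]
    simp only
    omega
  · intro i hi
    obtain ⟨j, hj, rfl⟩ := Finset.mem_map.mp hi
    exact Tuple.monotone_sort v (Finset.mem_Ici.mp hj)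

lemma acceptProb_add_rejectProb {n : ℕ} (P : SingleCopyProtocol n) {ρ : Op n} (hρ : IsState ρ) :
    P.acceptProb ρ + P.rejectProb ρ = 1 := by
  rw [SingleCopyProtocol.acceptProb, SingleCopyProtocol.rejectProb, expectation_eq_productExp,
    expectation_eq_productExp, ← productExp_add,
    ← productExp_const (fun i => (P.measurement i).sum_prob hρ) 1]
  congr 1
  funext ω
  exact congrFun (Set.indicator_self_add_compl P.accept 1) ω

/-- The estimate from one run is off by at least `ε²` with probability at most `1 / 15`. -/
lemma fafEstimate_deviation_le {n M : ℕ} (hM : 2 ≤ M) {ε : ℝ} (hε : 0 < ε)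
    (hvar : 256 * ((n : ℝ) ^ 2 / M + (n : ℝ) ^ 3 / (M : ℝ) ^ 2) ≤ ε ^ 4 / 15) {ρ : Op n}
    (hρ : IsState ρ) :
    productExp (fun p => (runMeasurement n M p).prob ρ)
      ({ω | ε ^ 2 ≤ |fafEstimate ω - faf 1 ρ|}.indicator 1) ≤ 1 / 15 := by
  have hc := productExp_chebyshev (w := fun p => (runMeasurement n M p).prob ρ)
    (fun _ x => POVM.prob_nonneg _ hρ x) fafEstimate (faf 1 ρ) (t := ε ^ 2) (by positivity)
    (S := {ω | ε ^ 2 ≤ |fafEstimate ω - faf 1 ρ|}) fun ω h => h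
  refine hc.trans ?_
  have hv := (variance_fafEstimate_le hM hρ (faf_one_nonneg hρ)).trans hvar
  rw [variance, expectation_fafEstimate hM hρ, expectation_eq_productExp] at hv
  rw [div_le_iff₀ (by positivity)]
  refine hv.trans (le_of_eq ?_)
  ring

lemma matchingProtocol_error_le {n M : ℕ} (k : ℕ) (hM : 2 ≤ M) {ε : ℝ} (hε : 0 < ε)
    (hvar : 256 * ((n : ℝ) ^ 2 / M + (n : ℝ) ^ 3 / (M : ℝ) ^ 2) ≤ ε ^ 4 / 15) {ρ : Op n}
    (hρ : IsState ρ) (T : Set (Fin (2 * k + 1) × (Fin (2 * n - 1) × Fin M) → Fin n → ℤˣ))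
    (hT : ∀ ω ∈ T, ∃ A : Finset (Fin (2 * k + 1)), k + 1 ≤ A.card ∧
      ∀ i ∈ A, ε ^ 2 ≤ |fafEstimate (fun p => ω (i, p)) - faf 1 ρ|) :
    expectation (matchingProtocol n M k (ε ^ 2)).measurement ρ (T.indicator 1) ≤ (1 / 4) ^ k :=
  productExp_majority (w := fun p => (runMeasurement n M p).prob ρ)
    (fun _ x => POVM.prob_nonneg _ hρ x) (fun _ => POVM.sum_prob _ hρ) k
    {ω | ε ^ 2 ≤ |fafEstimate ω - faf 1 ρ|} (fafEstimate_deviation_le hM hε hvar hρ) T hT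

/-- The true value is `0` or at least `2 ε²`. A median on the wrong side of `ε²` puts at least `k +
1` runs at distance at least `ε²` from the true value. -/
lemma matchingProtocol_isTester {n M k : ℕ} (hM : 2 ≤ M) {ε δ : ℝ} (hε : 0 < ε) (hε1 : ε ≤ 1)
    (hvar : 256 * ((n : ℝ) ^ 2 / M + (n : ℝ) ^ 3 / (M : ℝ) ^ 2) ≤ ε ^ 4 / 15)
    (hk : (1 / 4 : ℝ) ^ k ≤ δ) :
    (matchingProtocol n M k (ε ^ 2)).IsGaussianityTester ε δ := by
  constructor
  · intro ψ hψ
    have hρ := isState_ketbra hψ.1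
    have h := matchingProtocol_error_le k hM hε hvar hρ
      (matchingProtocol n M k (ε ^ 2)).acceptᶜ (by
        intro ω hω
        have hω' : ε ^ 2 < median (fun i => fafEstimate fun p => ω (i, p)) := not_le.mp hω
        obtain ⟨A, hA, h⟩ := exists_card_median_le fun i => fafEstimate fun p => ω (i, p)
        refine ⟨A, hA, fun i hi => ?_⟩
        rw [faf_one_of_gaussian hψ, sub_zero]
        exact (hω'.le.trans (h i hi)).trans (le_abs_self _))
    have hs := acceptProb_add_rejectProb (matchingProtocol n M k (ε ^ 2)) hρ
    have h' : (matchingProtocol n M k (ε ^ 2)).rejectProb (ketbra ψ) ≤ (1 / 4) ^ k := h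
    linarith
  · intro ψ hψ hd
    have hρ := isState_ketbra hψ
    have hfaf := two_mul_sq_le_faf hψ hε.le hε1 hd
    have h := matchingProtocol_error_le k hM hε hvar hρ
      (matchingProtocol n M k (ε ^ 2)).accept (by
        intro ω hω
        have hω' : median (fun i => fafEstimate fun p => ω (i, p)) ≤ ε ^ 2 := hω
        obtain ⟨A, hA, h⟩ := exists_card_le_median fun i => fafEstimate fun p => ω (i, p)
        refine ⟨A, hA, fun i hi => ?_⟩
        have := h i hi
        rw [abs_sub_comm]
        refine le_trans ?_ (le_abs_self _)
        linarith)
    have hs := acceptProb_add_rejectProb (matchingProtocol n M k (ε ^ 2)) hρ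
    have h' : (matchingProtocol n M k (ε ^ 2)).acceptProb (ketbra ψ) ≤ (1 / 4) ^ k := h
    linarith

lemma matchingProtocol_shots (n M k : ℕ) (τ : ℝ) :
    (matchingProtocol n M k τ).shots = (2 * k + 1) * ((2 * n - 1) * M) := by
  change Fintype.card (Fin (2 * k + 1) × (Fin (2 * n - 1) × Fin M)) = _
  simp

/-- Shots per layer that make the variance of one run small. -/
lemma exists_shots_per_layer {n : ℕ} (hn : 1 ≤ n) {ε : ℝ} (hε : 0 < ε) (hε1 : ε ≤ 1) :
    ∃ M : ℕ, 2 ≤ M ∧ (M : ℝ) ≤ 16000 * ((n : ℝ) ^ 2 / ε ^ 4) ∧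
      256 * ((n : ℝ) ^ 2 / M + (n : ℝ) ^ 3 / (M : ℝ) ^ 2) ≤ ε ^ 4 / 15 := by
  have hn' : (1 : ℝ) ≤ n := by exact_mod_cast hn
  set x : ℝ := (n : ℝ) ^ 2 / ε ^ 4 with hx
  have hε4 : ε ^ 4 ≤ 1 := pow_le_one₀ hε.le hε1
  have hx1 : 1 ≤ x := by
    rw [hx, le_div_iff₀ (by positivity), one_mul]
    exact hε4.trans (one_le_pow₀ hn')
  -- The choice is `M = ⌈8000 x⌉`: each of the two terms is then at most `ε⁴ / 8000`, and `256 * 2 /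
  -- 8000 < 1 / 15`. Rounding up is absorbed by `x ≥ 1`, whence the bound `16000 x`.
  have hge : 8000 * x ≤ (⌈8000 * x⌉₊ : ℝ) := Nat.le_ceil _
  have hM0 : (0 : ℝ) < 8000 * x := by linarith
  have hnx : (n : ℝ) ^ 2 = x * ε ^ 4 := by rw [hx]; field_simp
  have hn3 : (n : ℝ) ^ 3 ≤ x ^ 2 * ε ^ 4 := by
    calc (n : ℝ) ^ 3 ≤ (n : ℝ) ^ 4 := pow_le_pow_right₀ hn' (by norm_num)
      _ = x ^ 2 * ε ^ 4 * ε ^ 4 := by rw [show (n : ℝ) ^ 4 = ((n : ℝ) ^ 2) ^ 2 by ring, hnx]; ring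
      _ ≤ x ^ 2 * ε ^ 4 * 1 := by gcongr
      _ = _ := mul_one _
  refine ⟨⌈8000 * x⌉₊, ?_, ?_, ?_⟩
  · have : (2 : ℝ) ≤ (⌈8000 * x⌉₊ : ℝ) := by linarith
    exact_mod_cast this
  · have := (Nat.ceil_lt_add_one hM0.le).le
    linarith
  · have h1 : (n : ℝ) ^ 2 / (⌈8000 * x⌉₊ : ℝ) ≤ ε ^ 4 / 8000 := by
      calc _ ≤ (n : ℝ) ^ 2 / (8000 * x) := by gcongr
        _ = _ := by rw [hnx]; field_simp
    have h2 : (n : ℝ) ^ 3 / (⌈8000 * x⌉₊ : ℝ) ^ 2 ≤ ε ^ 4 / 8000 := by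
      calc _ ≤ x ^ 2 * ε ^ 4 / (8000 * x) ^ 2 := by gcongr
        _ = ε ^ 4 / (8000 * 8000) := by field_simp
        _ ≤ _ := by gcongr; norm_num
    have : 0 < ε ^ 4 := by positivity
    linarith

/-- The number of runs that makes the error probability of the median small. -/
lemma exists_runs {δ₀ δ : ℝ} (h1 : δ₀ < 1) (hδ : 0 < δ) (hδ₀ : δ ≤ δ₀) :
    ∃ k : ℕ, (1 / 4 : ℝ) ^ k ≤ δ ∧
      ((2 * k + 1 : ℕ) : ℝ) ≤ (2 + 3 / Real.log (1 / δ₀)) * Real.log (1 / δ) := by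
  have h0 : 0 < δ₀ := hδ.trans_le hδ₀
  have hL0 : 0 < Real.log (1 / δ₀) := Real.log_pos (by rw [lt_div_iff₀ h0]; linarith)
  have hL : Real.log (1 / δ₀) ≤ Real.log (1 / δ) :=
    Real.log_le_log (by positivity) (one_div_le_one_div_of_le hδ hδ₀)
  have hk := Nat.le_ceil (Real.log (1 / δ))
  have hk' := Nat.ceil_lt_add_one (hL0.le.trans hL)
  -- Since `1/4 ≤ e⁻¹`, this many factors suffice. Rounding gives `2k + 1 ≤ 2 log (1/δ) + 3`, and
  -- the `3` is absorbed using `log (1/δ) ≥ log (1/δ₀) > 0`; this is why the constant depends on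
  -- `δ₀`.
  refine ⟨⌈Real.log (1 / δ)⌉₊, ?_, ?_⟩
  · have h4 : (1 / 4 : ℝ) ≤ Real.exp (-1) := by
      rw [Real.exp_neg, ← one_div]
      exact one_div_le_one_div_of_le (Real.exp_pos 1) (by linarith [Real.exp_one_lt_d9])
    calc (1 / 4 : ℝ) ^ ⌈Real.log (1 / δ)⌉₊ ≤ Real.exp (-1) ^ ⌈Real.log (1 / δ)⌉₊ := by gcongr
      _ = Real.exp (-(⌈Real.log (1 / δ)⌉₊ : ℝ)) := by rw [← Real.exp_nat_mul]; ring_nf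
      _ ≤ Real.exp (-Real.log (1 / δ)) := Real.exp_le_exp.mpr (neg_le_neg hk)
      _ = δ := by rw [one_div, Real.log_inv, neg_neg, Real.exp_log hδ]
  · have h3 : 3 ≤ 3 / Real.log (1 / δ₀) * Real.log (1 / δ) := by
      rw [div_mul_eq_mul_div, le_div_iff₀ hL0]
      linarith
    push_cast
    rw [add_mul]
    linarith

end

end FermionTest

theorem mainTheorem2 :
    -- the bilinears split into `2n - 1` layers of `n` commuting pairs each
    (∀ n : ℕ,
      (∀ (ℓ : Fin (2 * n - 1)) (j : Fin n),
        (FermionTest.layerPair ℓ j).1 < (FermionTest.layerPair ℓ j).2) ∧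
      (∀ a b : Fin (2 * n), a < b →
        ∃! p : Fin (2 * n - 1) × Fin n, FermionTest.layerPair p.1 p.2 = (a, b)) ∧
      (∀ (ℓ : Fin (2 * n - 1)) (i j : Fin n),
        Commute (FermionTest.layerBilinear ℓ i) (FermionTest.layerBilinear ℓ j))) ∧
    -- the estimator of one run is unbiased, with variance `O(n² / M + n³ / M²)`
    (∃ C : ℝ, 0 < C ∧ ∀ (n M : ℕ), 1 ≤ n → 2 ≤ M →
      ∀ ρ : FermionTest.Op n, FermionTest.IsState ρ →
        FermionTest.expectation (FermionTest.runMeasurement n M) ρ FermionTest.fafEstimate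
          = FermionTest.faf 1 ρ ∧
        FermionTest.variance (FermionTest.runMeasurement n M) ρ FermionTest.fafEstimate
          ≤ C * ((n : ℝ) ^ 2 / M + (n : ℝ) ^ 3 / (M : ℝ) ^ 2)) ∧
    -- the median over independent runs gives a tester with `O((n³ / ε⁴) log (1 / δ))` shots
    (∀ δ₀ : ℝ, 0 < δ₀ → δ₀ < 1 → ∃ C : ℝ, 0 < C ∧
      ∀ (n : ℕ) (ε δ : ℝ), 1 ≤ n → 0 < ε → ε ≤ 1 → 0 < δ → δ ≤ δ₀ →
        ∃ M k : ℕ, 2 ≤ M ∧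
          ((FermionTest.matchingProtocol n M k (ε ^ 2)).shots : ℝ)
            ≤ C * ((n : ℝ) ^ 3 / ε ^ 4) * Real.log (1 / δ) ∧
          (FermionTest.matchingProtocol n M k (ε ^ 2)).IsGaussianityTester ε δ) := by
  refine ⟨fun n => ⟨FermionTest.layerPair_lt, fun _ _ => FermionTest.existsUnique_layerPair,
    FermionTest.layerBilinear_commute⟩, ⟨256, by norm_num, fun n M _ hM ρ hρ =>
      ⟨FermionTest.expectation_fafEstimate hM hρ,
        FermionTest.variance_fafEstimate_le hM hρ (FermionTest.faf_one_nonneg hρ)⟩⟩, ?_⟩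
  intro δ₀ h0 h1
  have hL0 : 0 < Real.log (1 / δ₀) := Real.log_pos (by rw [lt_div_iff₀ h0]; linarith)
  -- The factor `32000` is `2 * 16000`: at most `2n` layers, each with `M ≤ 16000 n² / ε⁴` shots per
  -- run.
  refine ⟨(2 + 3 / Real.log (1 / δ₀)) * 32000, by positivity, ?_⟩
  intro n ε δ hn hε hε1 hδ hδ₀
  obtain ⟨M, hM, hMle, hvar⟩ := FermionTest.exists_shots_per_layer hn hε hε1
  obtain ⟨k, hk, hkle⟩ := FermionTest.exists_runs h1 hδ hδ₀
  refine ⟨M, k, hM, ?_, FermionTest.matchingProtocol_isTester hM hε hε1 hvar hk⟩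
  have hlayers : ((2 * n - 1 : ℕ) : ℝ) ≤ 2 * n := by
    have : 2 * n - 1 ≤ 2 * n := by omega
    exact_mod_cast this
  rw [FermionTest.matchingProtocol_shots, Nat.cast_mul, Nat.cast_mul]
  calc _ ≤ (2 + 3 / Real.log (1 / δ₀)) * Real.log (1 / δ) *
        (2 * (n : ℝ) * (16000 * ((n : ℝ) ^ 2 / ε ^ 4))) :=
        mul_le_mul hkle (mul_le_mul hlayers hMle (Nat.cast_nonneg _) (by positivity))
          (by positivity) (le_trans (Nat.cast_nonneg _) hkle)
    _ = _ := by ring
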